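/- Let $d\in\mathbb N$, $p\ge 1$, and let $\mathscr P_p(\mathbb R^d)$ be the space of Borel probability measures on $\mathbb R^d$ with finite $p$-moment, with the $p$-Wasserstein distance $W_p$. Let $L>0$ and let $F:\mathscr P_p(\mathbb R^d)\times\mathbb R^d\rightrightarrows\mathbb R^d$ be a set-valued map with nonempty, convex and compact images that is Lipschitz continuous with constant $L$: $F(\mu_2,x_2)\subseteq F(\mu_1,x_1)+L\,(W_p(\mu_1,\mu_2)+|x_1-x_2|)\,\overline{B(0,1)}$. For $a\le b$ and $\mu\in\mathscr P_p(\mathbb R^d)$ let $\mathcal A_{[a,b]}(\mu)$ be the set of $W_p$-continuous curves $\{\mu_t\}_{t\in[a,b]}\subseteq\mathscr P_p(\mathbb R^d)$ with $\mu_a=\mu$ for which there is a family of $\mathbb R^d$-valued Borel measures $\nu_t=v_t\mu_t$, with $v$ Borel in $(t,x)$ and $v_t\in L^1(\mu_t;\mathbb R^d)$ for a.e. $t$, such that $v_t(x)\in F(\mu_t,x)$ for a.e. $t\in[a,b]$ and $\mu_t$-a.e. $x$, and $\partial_t\mu_t+\mathrm{div}\,\nu_t=0$ in the sense of distributions; that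 is, for every $\varphi\in C^1_c(\mathbb R^d)$ the function $t\mapsto\int\varphi\,d\mu_t$ is absolutely continuous on $[a,b]$ with derivative $\int\langle\nabla\varphi,v_t\rangle\,d\mu_t$ for a.e. $t$. Let $\Phi\subseteq C^0_b(\mathbb R^d)$ be such that $\tilde S^\Phi=\{\mu\in\mathscr P(\mathbb R^d):\int\varphi\,d\mu\le 0\ \text{for all }\varphi\in\Phi\}$ is nonempty; put $\tilde S^\Phi_p=\tilde S^\Phi\cap\mathscr P_p(\mathbb R^d)$ and $\sigma_\Phi(\mu)=\sup_{\varphi\in\Phi}\int\varphi\,d\mu$. Assume that $\sigma_\Phi\ge 0$ on $\mathscr P_p(\mathbb R^d)$, so that $\sigma_\Phi$ vanishes exactly on $\tilde S^\Phi_p$ (for instance $0\in\Phi$; adding the function $0$ to $\Phi$ does not change the target). The minimum time is $$\tilde T_p(\mu)=\inf\{T\ge 0:\ \text{there is }\{\mu_t\}_{t\in[0,T]}\in\mathcal A_{[0,T]}(\mu)\text{ with }\mu_T\in\tilde S^\Phi_p\}\in[0,+\infty],\qquad \inf\emptyset=+\infty .$$ Put $\ell=\min\{1,\tfrac1{2L}\}$.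 Let $r:[0,+\infty[\,\to[0,\ell]$ and $Q:[0,\ell]\times[0,+\infty[\,\to\mathbb R$ be continuous, and suppose that $\tilde S^\Phi_p$ is $(r,Q)$-attainable, that is: 1. $r(q)=0$ if and only if $q=0$; 2. $Q(r(q),q)<0$ for all $q>0$; 3. $q\mapsto \dfrac{r(q)}{|Q(r(q),q)|}$ is nonincreasing on $]0,+\infty[$ and integrable on $[0,R]$ for every $R>0$; 4. for every $\mu\in\mathscr P_p(\mathbb R^d)\setminus\tilde S^\Phi_p$ we have $\sigma_\Phi(\mu)<+\infty$ and there is $\{\mu_t\}\in\mathcal A_{[0,r(\sigma_\Phi(\mu))]}(\mu)$ with $$\inf_{t\in[0,r(\sigma_\Phi(\mu))]}\{\sigma_\Phi(\mu_t)-\sigma_\Phi(\mu)\}\le 2\,Q\big(r(\sigma_\Phi(\mu)),\sigma_\Phi(\mu)\big).$$ Then for every $\mu\in\mathscr P_p(\mathbb R^d)$ $$\tilde T_p(\mu)\le\int_0^{\sigma_\Phi(\mu)}\frac{r(q)}{|Q(r(q),q)|}\,dq .$$ -/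

import Mathlib

open Set Filter Topology MeasureTheory
open scoped NNReal ENNReal Pointwise BoundedContinuousFunction

namespace WassersteinControl

noncomputable section

/-- The state space `ℝ^d` with its Euclidean norm. -/
abbrev Rd (d : ℕ) : Type := EuclideanSpace ℝ (Fin d)

/-- The Borel probability measures on `ℝ^d` with finite `p`-moment. -/
def Pp (d : ℕ) (p : ℝ) : Type :=
  {μ : ProbabilityMeasure (Rd d) // ∫⁻ x, ‖x‖ₑ ^ p ∂(μ : Measure (Rd d)) < ∞}

/-- The underlying Borel measure of an element of `Pp d p`. -/
def Pp.toMeasure {d : ℕ} {p : ℝ} (μ : Pp d p) : Measure (Rd d) :=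
  ((μ.1 : ProbabilityMeasure (Rd d)) : Measure (Rd d))

/-- The admissible transport plans between two Borel measures: the Borel measures on
`ℝ^d × ℝ^d` with the prescribed marginals. -/
def transportPlans {d : ℕ} (μ ν : Measure (Rd d)) : Set (Measure (Rd d × Rd d)) :=
  {π | π.map Prod.fst = μ ∧ π.map Prod.snd = ν}

/-- The `p`-Wasserstein distance on `Pp d p`. The infimum is finite there, because the product
measure is a transport plan with finite cost. -/
def Wp {d : ℕ} {p : ℝ} (μ ν : Pp d p) : ℝ :=
  ((⨅ π ∈ transportPlans μ.toMeasure ν.toMeasure,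
    ∫⁻ z, edist z.1 z.2 ^ p ∂π) ^ (1 / p)).toReal

/-- The standing hypothesis on the dynamics: nonempty, convex and compact images, and Lipschitz
continuity with constant `L > 0` with respect to `Wp μ₁ μ₂ + |x₁ - x₂|`. -/
structure IsLipschitzDynamics {d : ℕ} {p : ℝ} (F : Pp d p → Rd d → Set (Rd d)) (L : ℝ) :
    Prop where
  pos : 0 < L
  nonempty : ∀ μ x, (F μ x).Nonempty
  convex : ∀ μ x, Convex ℝ (F μ x)
  compact : ∀ μ x, IsCompact (F μ x)
  lipschitz : ∀ μ₁ x₁ μ₂ x₂,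
    F μ₂ x₂ ⊆ F μ₁ x₁ + (L * (Wp μ₁ μ₂ + dist x₁ x₂)) • Metric.closedBall (0 : Rd d) 1

/-- `μ` is an admissible trajectory on `[a, b]` driven by the family `ν` of vector measures, with
underlying dynamics `F`. Only the values of `μ` and `ν` at times in `[a, b]` matter.

The Borel field `v` is the density of `ν t` with respect to `μ t`; by Radon--Nikodym the clause
`density` says that the finite vector measure `ν t` satisfies `|ν t| ≪ μ t` and has density `v t`.
The continuity equation `∂ₜ μ + div ν = 0` is the distributional identity
`d/dt ∫ φ dμ_t = ∫ ⟨∇φ, v_t⟩ dμ_t` on `(a, b)` for all `φ ∈ C¹_c`: the left-hand integral is an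
absolutely continuous function of `t` whose derivative is the right-hand side almost everywhere. -/
structure IsDrivenBy {d : ℕ} {p : ℝ} (F : Pp d p → Rd d → Set (Rd d)) (a b : ℝ)
    (μ : ℝ → Pp d p) (ν : ℝ → VectorMeasure (Rd d) (Rd d)) (v : ℝ → Rd d → Rd d) : Prop where
  measurable : Measurable (Function.uncurry v)
  density : ∀ᵐ t ∂(volume.restrict (Icc a b)),
    Integrable (v t) (μ t).toMeasure ∧ ν t = (μ t).toMeasure.withDensityᵥ (v t)
  inclusion : ∀ᵐ t ∂(volume.restrict (Icc a b)),
    ∀ᵐ x ∂(μ t).toMeasure, v t x ∈ F (μ t) x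
  continuityEquation : ∀ φ : Rd d → ℝ, ContDiff ℝ 1 φ → HasCompactSupport φ →
    AbsolutelyContinuousOnInterval (fun t => ∫ x, φ x ∂(μ t).toMeasure) a b ∧
    ∀ᵐ t ∂(volume.restrict (Icc a b)),
      HasDerivAt (fun s => ∫ x, φ x ∂(μ s).toMeasure)
        (∫ x, inner ℝ (gradient φ x) (v t x) ∂(μ t).toMeasure) t

/-- The set of `Wp`-continuous admissible trajectories on `[a, b]` that start from `μ₀`. -/
def admissibleTrajectories {d : ℕ} {p : ℝ} (F : Pp d p → Rd d → Set (Rd d)) (a b : ℝ)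
    (μ₀ : Pp d p) : Set (ℝ → Pp d p) :=
  {μ | μ a = μ₀ ∧
    (∀ t ∈ Icc a b, Tendsto (fun s => Wp (μ s) (μ t)) (𝓝[Icc a b] t) (𝓝 0)) ∧
    ∃ ν v, IsDrivenBy F a b μ ν v}

/-- The generalized target generated by `Φ`, as a set of Borel probability measures. -/
def genTarget {d : ℕ} (Φ : Set (Rd d →ᵇ ℝ)) : Set (ProbabilityMeasure (Rd d)) :=
  {μ | ∀ φ ∈ Φ, ∫ x, φ x ∂(μ : Measure (Rd d)) ≤ 0}

/-- The part of the generalized target that lies in `Pp d p`. -/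
def genTargetP {d : ℕ} (p : ℝ) (Φ : Set (Rd d →ᵇ ℝ)) : Set (Pp d p) :=
  {μ | μ.1 ∈ genTarget Φ}

/-- The generalized minimum time function, with values in `[0, +∞]`; the infimum of the empty set
is `+∞`. -/
def minTime {d : ℕ} {p : ℝ} (F : Pp d p → Rd d → Set (Rd d)) (Φ : Set (Rd d →ᵇ ℝ))
    (μ : Pp d p) : ℝ≥0∞ :=
  ⨅ (T : ℝ≥0) (_ : ∃ θ ∈ admissibleTrajectories F 0 T μ, θ T ∈ genTargetP p Φ), (T : ℝ≥0∞)

/-- `σ_Φ(μ) = sup_{φ ∈ Φ} ∫ φ dμ`, as an extended real number. -/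
def sigma {d : ℕ} {p : ℝ} (Φ : Set (Rd d →ᵇ ℝ)) (μ : Pp d p) : EReal :=
  ⨆ φ ∈ Φ, ((∫ x, φ x ∂μ.toMeasure : ℝ) : EReal)

/-- `(r, Q)`-attainability of the generalized target generated by `Φ`, where `L` is the Lipschitz
constant of `F`. The maps `r` and `Q` are only evaluated on `[0, ∞)` and on
`[0, min {1, 1 / (2 L)}] × [0, ∞)`. Outside the target `σ_Φ` has to be finite, since `r` is
evaluated at it. The quotient `r(q) / |Q(r(q), q)|` may be undefined at `q = 0`, so monotonicity
is required on `(0, ∞)`; integrability is required near every point of `[0, ∞)`, that is, on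
every interval `[0, R]`. -/
structure IsAttainable {d : ℕ} {p : ℝ} (F : Pp d p → Rd d → Set (Rd d)) (L : ℝ)
    (Φ : Set (Rd d →ᵇ ℝ)) (r : ℝ → ℝ) (Q : ℝ → ℝ → ℝ) : Prop where
  r_continuous : ContinuousOn r (Ici 0)
  r_mapsTo : MapsTo r (Ici 0) (Icc 0 (min 1 (1 / (2 * L))))
  Q_continuous : ContinuousOn (Function.uncurry Q) (Icc 0 (min 1 (1 / (2 * L))) ×ˢ Ici 0)
  r_eq_zero_iff : ∀ q, 0 ≤ q → (r q = 0 ↔ q = 0)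
  Q_neg : ∀ q, 0 < q → Q (r q) q < 0
  antitone : AntitoneOn (fun q => r q / |Q (r q) q|) (Ioi 0)
  integrable : LocallyIntegrableOn (fun q => r q / |Q (r q) q|) (Ici 0)
  decrease : ∀ μ : Pp d p, μ ∉ genTargetP p Φ → ∃ s : ℝ, sigma Φ μ = (s : EReal) ∧
    ∃ θ ∈ admissibleTrajectories F 0 (r s) μ,
      (⨅ t ∈ Icc 0 (r s), (sigma Φ (θ t) - sigma Φ μ)) ≤ ((2 * Q (r s) s : ℝ) : EReal)

end

end WassersteinControl

namespace WassersteinControl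

noncomputable section

/-! The proof iterates the attainability step. From a measure outside the target with `σ_Φ = s`,
some admissible trajectory of duration `t ≤ r(s)` ends at a measure with `σ_Φ = s' ≤ s - |Q(r(s),
s)|` (`IsAttainable.exists_step`). Since `r/|Q|` is nonincreasing, `r(s)` is at most its integral
over `[s', s]` (`IsAttainable.r_le_integral`). These integrals telescope, so the total elapsed time
never exceeds the integral from `0` to `σ_Φ(μ)`.

If the target is reached after finitely many steps, concatenation finishes the proof. Otherwise the
values of `σ_Φ` decrease to a limit, which continuity of `r` and `Q` together with `Q < 0` forces to
be `0` (`IsAttainable.tendsto_zero`), while the times increase to a finite `T`. It remains to give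
the infinite concatenation a value at `T` that keeps it admissible; this is the analytic core,
`exists_update_mem_admissibleTrajectories`.

Near `T` three facts are combined. Linear growth of `F` and Grönwall bound the `p`-moments, so the
curve is tight. Integrals of `C¹_c` functions are uniformly Lipschitz in time, so the narrow limit
at `T` is unique. Finally, the damped moments `moment lam` satisfy a Grönwall bound with a rate
independent of `lam`; as they vanish at the initial measure when `lam → ∞`, the `p`-th powers are
uniformly integrable, and narrow convergence improves to `W_p`-convergence
(`tendsto_Wp_of_tendsto`).

The limit lies in the target because each `∫ φ` with `φ ∈ Φ` passes to narrow limits and is bounded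
along the sequence by `σ_Φ`, which tends to `0`. -/

instance {d : ℕ} {p : ℝ} (μ : Pp d p) : IsProbabilityMeasure μ.toMeasure := μ.1.2

/-! ### Transport plans, moments and finiteness of the cost. -/

/-- The transport cost `W_p ^ p`. -/
def transportCost {d : ℕ} (p : ℝ) (μ ν : Measure (Rd d)) : ℝ≥0∞ :=
  ⨅ π ∈ transportPlans μ ν, ∫⁻ z, edist z.1 z.2 ^ p ∂π

lemma Wp_eq {d : ℕ} {p : ℝ} (μ ν : Pp d p) :
    Wp μ ν = (transportCost p μ.toMeasure ν.toMeasure ^ (1 / p)).toReal := rfl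

lemma Wp_nonneg {d : ℕ} {p : ℝ} (μ ν : Pp d p) : 0 ≤ Wp μ ν := ENNReal.toReal_nonneg

lemma transportCost_le {d : ℕ} {p : ℝ} {μ ν : Measure (Rd d)} {π : Measure (Rd d × Rd d)}
    (hπ : π ∈ transportPlans μ ν) : transportCost p μ ν ≤ ∫⁻ z, edist z.1 z.2 ^ p ∂π :=
  iInf₂_le _ hπ

lemma lintegral_fst_of_mem_transportPlans {d : ℕ} {μ ν : Measure (Rd d)}
    {π : Measure (Rd d × Rd d)} (hπ : π ∈ transportPlans μ ν) {f : Rd d → ℝ≥0∞}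
    (hf : Measurable f) : ∫⁻ z, f z.1 ∂π = ∫⁻ x, f x ∂μ := by
  rw [← hπ.1, lintegral_map hf measurable_fst]

lemma lintegral_snd_of_mem_transportPlans {d : ℕ} {μ ν : Measure (Rd d)}
    {π : Measure (Rd d × Rd d)} (hπ : π ∈ transportPlans μ ν) {f : Rd d → ℝ≥0∞}
    (hf : Measurable f) : ∫⁻ z, f z.2 ∂π = ∫⁻ x, f x ∂ν := by
  rw [← hπ.2, lintegral_map hf measurable_snd]

/-- The normalised product of two measures of the same finite mass. -/
lemma prod_mem_transportPlans {d : ℕ} (μ ν : Measure (Rd d)) [IsFiniteMeasure μ]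
    [IsFiniteMeasure ν] (h : μ univ = ν univ) :
    (μ univ)⁻¹ • μ.prod ν ∈ transportPlans μ ν := by
  have key : ∀ ρ : Measure (Rd d), ρ univ = μ univ → (μ univ)⁻¹ • (μ univ • ρ) = ρ := by
    intro ρ hρ
    rcases eq_or_ne (μ univ) 0 with h0 | h0
    · have : ρ = 0 := Measure.measure_univ_eq_zero.mp (hρ.trans h0)
      simp [this]
    · rw [smul_smul, ENNReal.inv_mul_cancel h0 (measure_ne_top _ _), one_smul]
  constructor
  · rw [Measure.map_smul, Measure.map_fst_prod, ← h]
    exact key μ rfl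
  · rw [Measure.map_smul, Measure.map_snd_prod]
    exact key ν h.symm

lemma edist_rpow_le {d : ℕ} {p : ℝ} (hp : 1 ≤ p) (x y : Rd d) :
    edist x y ^ p ≤ 2 ^ (p - 1) * (‖x‖ₑ ^ p + ‖y‖ₑ ^ p) := by
  have h : edist x y ≤ ‖x‖ₑ + ‖y‖ₑ := by
    rw [edist_eq_enorm_sub]; exact enorm_sub_le
  exact (ENNReal.rpow_le_rpow h (by linarith)).trans
    (ENNReal.rpow_add_le_mul_rpow_add_rpow _ _ hp)

lemma enorm_rpow_le {d : ℕ} {p : ℝ} (hp : 1 ≤ p) (x y : Rd d) :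
    ‖x‖ₑ ^ p ≤ 2 ^ (p - 1) * (edist x y ^ p + ‖y‖ₑ ^ p) := by
  have h : ‖x‖ₑ ≤ edist x y + ‖y‖ₑ := by
    rw [edist_eq_enorm_sub]
    calc ‖x‖ₑ = ‖(x - y) + y‖ₑ := by simp
      _ ≤ _ := enorm_add_le _ _
  exact (ENNReal.rpow_le_rpow h (by linarith)).trans
    (ENNReal.rpow_add_le_mul_rpow_add_rpow _ _ hp)

lemma measurable_enorm_rpow {d : ℕ} (p : ℝ) : Measurable fun x : Rd d => ‖x‖ₑ ^ p := by
  fun_prop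

lemma lintegral_edist_rpow_le {d : ℕ} {p : ℝ} (hp : 1 ≤ p) {μ ν : Measure (Rd d)}
    {π : Measure (Rd d × Rd d)} (hπ : π ∈ transportPlans μ ν) :
    ∫⁻ z, edist z.1 z.2 ^ p ∂π ≤
      2 ^ (p - 1) * (∫⁻ x, ‖x‖ₑ ^ p ∂μ + ∫⁻ x, ‖x‖ₑ ^ p ∂ν) := by
  calc ∫⁻ z, edist z.1 z.2 ^ p ∂π
      ≤ ∫⁻ z, 2 ^ (p - 1) * (‖z.1‖ₑ ^ p + ‖z.2‖ₑ ^ p) ∂π :=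
        lintegral_mono fun z => edist_rpow_le hp z.1 z.2
    _ = 2 ^ (p - 1) * (∫⁻ z, ‖z.1‖ₑ ^ p ∂π + ∫⁻ z, ‖z.2‖ₑ ^ p ∂π) := by
        rw [lintegral_const_mul _ (by fun_prop), lintegral_add_left (by fun_prop)]
    _ = _ := by
        rw [lintegral_fst_of_mem_transportPlans hπ (measurable_enorm_rpow p),
          lintegral_snd_of_mem_transportPlans hπ (measurable_enorm_rpow p)]

lemma Pp.lintegral_lt_top {d : ℕ} {p : ℝ} (μ : Pp d p) : ∫⁻ x, ‖x‖ₑ ^ p ∂μ.toMeasure < ∞ := μ.2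

lemma transportCost_lt_top {d : ℕ} {p : ℝ} (hp : 1 ≤ p) (μ ν : Pp d p) :
    transportCost p μ.toMeasure ν.toMeasure < ∞ := by
  refine (transportCost_le (prod_mem_transportPlans _ _ (by simp))).trans_lt ?_
  refine (lintegral_edist_rpow_le hp (prod_mem_transportPlans _ _ (by simp))).trans_lt ?_
  refine ENNReal.mul_lt_top ?_ (ENNReal.add_lt_top.2 ⟨μ.lintegral_lt_top, ν.lintegral_lt_top⟩)
  exact ENNReal.rpow_lt_top_of_nonneg (by linarith) (by simp)

lemma lintegral_enorm_rpow_le_of_Wp_lt_one {d : ℕ} {p : ℝ} (hp : 1 ≤ p) {μ ν : Pp d p}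
    (h : Wp μ ν < 1) :
    ∫⁻ x, ‖x‖ₑ ^ p ∂μ.toMeasure ≤ 2 ^ (p - 1) * (1 + ∫⁻ x, ‖x‖ₑ ^ p ∂ν.toMeasure) := by
  have hp0 : 0 < p := by linarith
  -- `toReal` sends `∞` to `0`, so `Wp μ ν < 1` says something about the cost only once the cost is
  -- known to be finite.
  have hfin : transportCost p μ.toMeasure ν.toMeasure ^ (1 / p) ≠ ∞ :=
    (ENNReal.rpow_lt_top_of_nonneg (by positivity) (transportCost_lt_top hp μ ν).ne).ne
  have h1 : transportCost p μ.toMeasure ν.toMeasure < 1 := by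
    by_contra hc
    have h1 := ENNReal.toReal_mono hfin
      (ENNReal.one_le_rpow (z := 1 / p) (not_lt.1 hc) (by positivity))
    exact absurd h (not_lt.2 (by simpa [Wp_eq] using h1))
  obtain ⟨π, hπ, hlt⟩ := by simpa only [transportCost, iInf_lt_iff, exists_prop] using h1
  calc ∫⁻ x, ‖x‖ₑ ^ p ∂μ.toMeasure = ∫⁻ z, ‖z.1‖ₑ ^ p ∂π :=
        (lintegral_fst_of_mem_transportPlans hπ (measurable_enorm_rpow p)).symm
    _ ≤ ∫⁻ z, 2 ^ (p - 1) * (edist z.1 z.2 ^ p + ‖z.2‖ₑ ^ p) ∂π :=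
        lintegral_mono fun z => enorm_rpow_le hp z.1 z.2
    _ = 2 ^ (p - 1) * (∫⁻ z, edist z.1 z.2 ^ p ∂π + ∫⁻ x, ‖x‖ₑ ^ p ∂ν.toMeasure) := by
        rw [lintegral_const_mul _ (by fun_prop), lintegral_add_left (by fun_prop),
          lintegral_snd_of_mem_transportPlans hπ (measurable_enorm_rpow p)]
    _ ≤ _ := by gcongr

lemma Wp_self {d : ℕ} {p : ℝ} (hp : 1 ≤ p) (μ : Pp d p) : Wp μ μ = 0 := by
  have hp0 : 0 < p := by linarith
  have hmem : μ.toMeasure.map (fun x => (x, x)) ∈ transportPlans μ.toMeasure μ.toMeasure := by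
    constructor
    · rw [Measure.map_map measurable_fst (by fun_prop)]; exact Measure.map_id
    · rw [Measure.map_map measurable_snd (by fun_prop)]; exact Measure.map_id
  have h := transportCost_le (p := p) hmem
  rw [lintegral_map (by fun_prop) (by fun_prop)] at h
  simp only [edist_self, ENNReal.zero_rpow_of_pos hp0, lintegral_zero, nonpos_iff_eq_zero] at h
  rw [Wp_eq, h, ENNReal.zero_rpow_of_pos (by positivity), ENNReal.toReal_zero]

/-- The Dirac mass at the origin. -/
def Pp.dirac (d : ℕ) {p : ℝ} (hp : 0 < p) : Pp d p :=
  ⟨⟨Measure.dirac 0, inferInstance⟩, by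
    simp [lintegral_dirac' _ (measurable_enorm_rpow p), ENNReal.zero_rpow_of_pos hp]⟩

lemma Wp_dirac_le {d : ℕ} {p : ℝ} (hp : 0 < p) (μ : Pp d p) :
    Wp (Pp.dirac d hp) μ ≤ ((∫⁻ x, ‖x‖ₑ ^ p ∂μ.toMeasure) ^ (1 / p)).toReal := by
  have hmem : μ.toMeasure.map (fun x => ((0 : Rd d), x)) ∈
      transportPlans (Pp.dirac d hp).toMeasure μ.toMeasure := by
    constructor
    · rw [Measure.map_map measurable_fst (by fun_prop)]
      change Measure.map (fun _ : Rd d => (0 : Rd d)) μ.toMeasure = Measure.dirac 0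
      simp [Measure.map_const]
    · rw [Measure.map_map measurable_snd (by fun_prop)]; exact Measure.map_id
  have h := transportCost_le (p := p) hmem
  rw [lintegral_map (by fun_prop) (by fun_prop)] at h
  simp only [edist_zero_left] at h
  rw [Wp_eq]
  exact ENNReal.toReal_mono
    (ENNReal.rpow_lt_top_of_nonneg (by positivity) μ.lintegral_lt_top.ne).ne
    (ENNReal.rpow_le_rpow h (by positivity))

/-! ### From narrow convergence to convergence in `W_p`. -/

lemma transportPlans_add {d : ℕ} {μ₁ μ₂ ν₁ ν₂ : Measure (Rd d)} {π₁ π₂ : Measure (Rd d × Rd d)}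
    (h₁ : π₁ ∈ transportPlans μ₁ ν₁) (h₂ : π₂ ∈ transportPlans μ₂ ν₂) :
    π₁ + π₂ ∈ transportPlans (μ₁ + μ₂) (ν₁ + ν₂) := by
  constructor
  · rw [Measure.map_add _ _ measurable_fst, h₁.1, h₂.1]
  · rw [Measure.map_add _ _ measurable_snd, h₁.2, h₂.2]

lemma transportPlans_sum {d : ℕ} {ι : Type*} (s : Finset ι) {μ ν : ι → Measure (Rd d)}
    {π : ι → Measure (Rd d × Rd d)} (h : ∀ i ∈ s, π i ∈ transportPlans (μ i) (ν i)) :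
    ∑ i ∈ s, π i ∈ transportPlans (∑ i ∈ s, μ i) (∑ i ∈ s, ν i) := by
  classical
  induction s using Finset.induction_on with
  | empty => simp [transportPlans]
  | insert i s hi ih =>
    rw [Finset.sum_insert hi, Finset.sum_insert hi, Finset.sum_insert hi]
    exact transportPlans_add (h i (Finset.mem_insert_self _ _))
      (ih fun j hj => h j (Finset.mem_insert_of_mem hj))

lemma measure_univ_eq_of_mem_transportPlans {d : ℕ} {μ ν : Measure (Rd d)}
    {π : Measure (Rd d × Rd d)} (h : π ∈ transportPlans μ ν) : π univ = μ univ := by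
  rw [← h.1, Measure.map_apply measurable_fst MeasurableSet.univ, preimage_univ]

lemma lintegral_edist_rpow_le_of_subset {d : ℕ} {p : ℝ} (hp : 0 ≤ p) {μ ν : Measure (Rd d)}
    {π : Measure (Rd d × Rd d)} (h : π ∈ transportPlans μ ν) {A : Set (Rd d)}
    (hA : MeasurableSet A) {ε : ℝ≥0∞} (hε : ∀ x ∈ A, ∀ y ∈ A, edist x y ≤ ε)
    (hμ : μ Aᶜ = 0) (hν : ν Aᶜ = 0) : ∫⁻ z, edist z.1 z.2 ^ p ∂π ≤ ε ^ p * μ univ := by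
  have h1 : ∀ᵐ z ∂π, z.1 ∈ A := by
    rw [ae_iff]
    rwa [← h.1, Measure.map_apply measurable_fst hA.compl] at hμ
  have h2 : ∀ᵐ z ∂π, z.2 ∈ A := by
    rw [ae_iff]
    rwa [← h.2, Measure.map_apply measurable_snd hA.compl] at hν
  calc ∫⁻ z, edist z.1 z.2 ^ p ∂π ≤ ∫⁻ _, ε ^ p ∂π := by
        refine lintegral_mono_ae ?_
        filter_upwards [h1, h2] with z hz1 hz2
        exact ENNReal.rpow_le_rpow (hε _ hz1 _ hz2) hp
    _ = _ := by rw [lintegral_const, measure_univ_eq_of_mem_transportPlans h]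

/-- The part of `μ` on `A`, rescaled to have mass `c`. -/
def massOn {d : ℕ} (μ : Measure (Rd d)) (A : Set (Rd d)) (c : ℝ≥0∞) : Measure (Rd d) :=
  (c / μ A) • μ.restrict A

lemma massOn_univ {d : ℕ} (μ : Measure (Rd d)) [IsFiniteMeasure μ] {A : Set (Rd d)} {c : ℝ≥0∞}
    (hc : c ≤ μ A) : massOn μ A c univ = c := by
  rw [massOn, Measure.smul_apply, Measure.restrict_apply_univ, smul_eq_mul]
  refine ENNReal.div_mul_cancel' (fun h => ?_) fun h => absurd h (measure_ne_top _ _)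
  rwa [h, nonpos_iff_eq_zero] at hc

lemma massOn_le {d : ℕ} (μ : Measure (Rd d)) {A : Set (Rd d)} {c : ℝ≥0∞}
    (hc : c ≤ μ A) : massOn μ A c ≤ μ.restrict A := by
  have h : c / μ A ≤ 1 := ENNReal.div_le_of_le_mul (by rwa [one_mul])
  refine Measure.le_iff.2 fun B _ => ?_
  rw [massOn, Measure.smul_apply, smul_eq_mul]
  exact (mul_le_mul_left h _).trans_eq (one_mul _)

lemma massOn_compl {d : ℕ} (μ : Measure (Rd d)) {A : Set (Rd d)} (hA : MeasurableSet A)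
    (c : ℝ≥0∞) : massOn μ A c Aᶜ = 0 := by
  rw [massOn, Measure.smul_apply, Measure.restrict_apply hA.compl]
  simp

/-- Splitting a probability measure into parts of prescribed mass on disjoint cells and a
remainder. -/
lemma exists_remainder {d : ℕ} (μ : Measure (Rd d)) [IsProbabilityMeasure μ] {ι : Type*}
    (s : Finset ι) {A : ι → Set (Rd d)} (hA : ∀ i, MeasurableSet (A i))
    (hd : (s : Set ι).PairwiseDisjoint A) {c : ι → ℝ≥0∞} (hc : ∀ i, c i ≤ μ (A i)) :
    ∃ ρ : Measure (Rd d), ρ ≤ μ ∧ ρ + ∑ i ∈ s, massOn μ (A i) (c i) = μ ∧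
      ρ univ + ∑ i ∈ s, c i = 1 := by
  have hle : ∑ i ∈ s, massOn μ (A i) (c i) ≤ μ := by
    calc ∑ i ∈ s, massOn μ (A i) (c i) ≤ ∑ i ∈ s, μ.restrict (A i) :=
          Finset.sum_le_sum fun i _ => massOn_le μ (hc i)
      _ = μ.restrict (⋃ i ∈ s, A i) := by
          refine Measure.ext fun B hB => ?_
          rw [Measure.restrict_biUnion_finset hd hA, Measure.finsetSum_apply,
            Measure.sum_apply _ hB, tsum_fintype]
          exact (Finset.sum_coe_sort s fun i => μ.restrict (A i) B).symm
      _ ≤ μ := Measure.restrict_le_self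
  have : IsFiniteMeasure (∑ i ∈ s, massOn μ (A i) (c i)) := isFiniteMeasure_of_le μ hle
  refine ⟨μ - ∑ i ∈ s, massOn μ (A i) (c i), Measure.sub_le, Measure.sub_add_cancel_of_le hle, ?_⟩
  have h := congrArg (fun m : Measure (Rd d) => m univ) (Measure.sub_add_cancel_of_le hle)
  simp only [Measure.add_apply, Measure.finsetSum_apply, measure_univ] at h
  rw [← h]
  congr 1
  exact Finset.sum_congr rfl fun i _ => (massOn_univ μ (hc i)).symm

/-- Matching the masses of two measures on small cells and transporting the remainders. -/
lemma exists_transportCost_le {d : ℕ} {p : ℝ} (hp : 1 ≤ p) (μ ν : Measure (Rd d))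
    [IsProbabilityMeasure μ] [IsProbabilityMeasure ν] {ι : Type*} (s : Finset ι)
    {A : ι → Set (Rd d)} (hA : ∀ i, MeasurableSet (A i))
    (hd : (s : Set ι).PairwiseDisjoint A) {ε : ℝ≥0∞}
    (hε : ∀ i, ∀ x ∈ A i, ∀ y ∈ A i, edist x y ≤ ε) :
    ∃ ρ ρ' : Measure (Rd d), ρ ≤ μ ∧ ρ' ≤ ν ∧
      ρ univ + ∑ i ∈ s, min (μ (A i)) (ν (A i)) = 1 ∧
      ρ' univ + ∑ i ∈ s, min (μ (A i)) (ν (A i)) = 1 ∧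
      transportCost p μ ν ≤
        2 ^ (p - 1) * (∫⁻ x, ‖x‖ₑ ^ p ∂ρ + ∫⁻ x, ‖x‖ₑ ^ p ∂ρ') + ε ^ p := by
  set c : ι → ℝ≥0∞ := fun i => min (μ (A i)) (ν (A i))
  have hcμ : ∀ i, c i ≤ μ (A i) := fun i => min_le_left _ _
  have hcν : ∀ i, c i ≤ ν (A i) := fun i => min_le_right _ _
  obtain ⟨ρ, hρ, hρμ, hρc⟩ := exists_remainder μ s hA hd hcμ
  obtain ⟨ρ', hρ', hρν, hρc'⟩ := exists_remainder ν s hA hd hcν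
  refine ⟨ρ, ρ', hρ, hρ', hρc, hρc', ?_⟩
  have hcs : ∑ i ∈ s, c i ≤ 1 := by rw [← hρc]; exact le_add_self
  have := isFiniteMeasure_of_le μ hρ
  have := isFiniteMeasure_of_le ν hρ'
  have := fun i => isFiniteMeasure_of_le _ (massOn_le μ (hcμ i))
  have := fun i => isFiniteMeasure_of_le _ (massOn_le ν (hcν i))
  -- Both remainders complement the same matched mass `∑ c i`; equal mass is what allows coupling
  -- them by a normalised product.
  have huniv : ρ univ = ρ' univ :=
    (ENNReal.add_left_inj (ne_top_of_le_ne_top ENNReal.one_ne_top hcs)).1 (hρc.trans hρc'.symm)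
  have h0 := prod_mem_transportPlans ρ ρ' huniv
  have hi : ∀ i ∈ s, (massOn μ (A i) (c i) univ)⁻¹ •
      (massOn μ (A i) (c i)).prod (massOn ν (A i) (c i)) ∈
      transportPlans (massOn μ (A i) (c i)) (massOn ν (A i) (c i)) := fun i _ =>
    prod_mem_transportPlans _ _ (by rw [massOn_univ μ (hcμ i), massOn_univ ν (hcν i)])
  have hπ := transportPlans_add h0 (transportPlans_sum s hi)
  rw [hρμ, hρν] at hπ
  refine (transportCost_le hπ).trans ?_
  rw [lintegral_add_measure, lintegral_finsetSum_measure]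
  refine add_le_add (lintegral_edist_rpow_le hp h0) ?_
  calc _ ≤ ∑ i ∈ s, ε ^ p * c i := by
        refine Finset.sum_le_sum fun i his => ?_
        have := lintegral_edist_rpow_le_of_subset (p := p) (by linarith) (hi i his) (hA i) (hε i)
          (massOn_compl μ (hA i) _) (massOn_compl ν (hA i) _)
        exact this.trans_eq (by rw [massOn_univ μ (hcμ i)])
    _ = ε ^ p * ∑ i ∈ s, c i := by rw [Finset.mul_sum]
    _ ≤ ε ^ p := mul_le_of_le_one_right' hcs

lemma null_frontier_diff {d : ℕ} {ν : Measure (Rd d)} {A B : Set (Rd d)}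
    (hA : ν (frontier A) = 0) (hB : ν (frontier B) = 0) : ν (frontier (A \ B)) = 0 := by
  rw [sdiff_eq]
  exact null_frontier_inter hA (by rwa [frontier_compl])

/-- Cells of small diameter with negligible boundary that cover the space. -/
lemma exists_partition_null_frontier {d : ℕ} (ν : Measure (Rd d)) [IsFiniteMeasure ν] {ε : ℝ}
    (hε : 0 < ε) :
    ∃ A : ℕ → Set (Rd d), (∀ n, MeasurableSet (A n)) ∧ (∀ n, ν (frontier (A n)) = 0) ∧
      Pairwise (Function.onFun Disjoint A) ∧ ⋃ n, A n = univ ∧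
      ∀ n, ∀ x ∈ A n, ∀ y ∈ A n, edist x y ≤ ENNReal.ofReal ε := by
  obtain ⟨u, hu⟩ := TopologicalSpace.exists_dense_seq (Rd d)
  -- Radii above `ε / 4` make the balls around a dense sequence cover the space, radii below `ε / 2`
  -- keep diameters at most `ε`, and this range leaves room to avoid spheres charged by `ν`.
  have hr := fun n => exists_null_frontier_thickening ν {u n} (show ε / 4 < ε / 2 by linarith)
  choose r hr hrf using hr
  simp only [Metric.thickening_singleton] at hrf
  refine ⟨disjointed fun n => Metric.ball (u n) (r n),
    fun n => MeasurableSet.disjointed (fun n => measurableSet_ball) n, fun n => ?_,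
    disjoint_disjointed _, ?_, fun n x hx y hy => ?_⟩
  · exact disjointedRec (p := fun A => ν (frontier A) = 0)
      (fun t i ht => null_frontier_diff ht (hrf i)) (hrf n)
  · rw [iUnion_disjointed, eq_univ_iff_forall]
    intro x
    obtain ⟨n, hn⟩ := hu.exists_dist_lt x (show 0 < ε / 4 by linarith)
    exact mem_iUnion.2 ⟨n, hn.trans (hr n).1⟩
  · have h1 := disjointed_subset _ n hx
    have h2 := disjointed_subset _ n hy
    rw [Metric.mem_ball] at h1 h2
    rw [edist_dist]
    refine ENNReal.ofReal_le_ofReal ?_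
    have := dist_triangle_right x y (u n)
    linarith [(hr n).2]

/-- Splitting at radius `R` bounds the cost of a remainder: inside the ball its small mass counts,
outside it the tail of the dominating measure. -/
lemma lintegral_enorm_rpow_le_of_le {d : ℕ} {p : ℝ} (hp : 0 ≤ p) {ρ μ : Measure (Rd d)}
    (h : ρ ≤ μ) (R : ℝ≥0) :
    ∫⁻ x, ‖x‖ₑ ^ p ∂ρ ≤ R ^ p * ρ univ + ∫⁻ x in {x | (R : ℝ) < ‖x‖}, ‖x‖ₑ ^ p ∂μ := by
  have hS : MeasurableSet {x : Rd d | (R : ℝ) < ‖x‖} := measurableSet_lt (by fun_prop) (by fun_prop)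
  rw [← lintegral_add_compl _ hS, add_comm]
  refine add_le_add ?_ (lintegral_mono' (Measure.restrict_mono le_rfl h) le_rfl)
  calc ∫⁻ x in {x | (R : ℝ) < ‖x‖}ᶜ, ‖x‖ₑ ^ p ∂ρ
      ≤ ∫⁻ x in {x | (R : ℝ) < ‖x‖}ᶜ, (R : ℝ≥0∞) ^ p ∂ρ := by
        refine setLIntegral_mono (by fun_prop) fun x hx => ENNReal.rpow_le_rpow ?_ hp
        have hx' : ‖x‖ ≤ R := by simpa using hx
        rw [← ofReal_norm, ← ENNReal.ofReal_coe_nnreal]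
        exact ENNReal.ofReal_le_ofReal hx'
    _ ≤ _ := by
        rw [setLIntegral_const]
        gcongr
        exact subset_univ _

/-- Narrow convergence and uniform integrability of the `p`-th powers give `W_p`-convergence. -/
lemma tendsto_Wp_of_tendsto {d : ℕ} {p : ℝ} (hp : 1 ≤ p) {ι : Type*} {l : Filter ι}
    {μ : ι → Pp d p} {ν : Pp d p} (hlim : Tendsto (fun i => (μ i).1) l (𝓝 ν.1))
    (hui : ∀ ε : ℝ≥0∞, 0 < ε → ∃ R : ℝ≥0, (∀ᶠ i in l,
      ∫⁻ x in {x | (R : ℝ) < ‖x‖}, ‖x‖ₑ ^ p ∂(μ i).toMeasure ≤ ε) ∧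
      ∫⁻ x in {x | (R : ℝ) < ‖x‖}, ‖x‖ₑ ^ p ∂ν.toMeasure ≤ ε) :
    Tendsto (fun i => Wp (μ i) ν) l (𝓝 0) := by
  have hp0 : 0 < p := by linarith
  have hcost : Tendsto (fun i => transportCost p (μ i).toMeasure ν.toMeasure) l (𝓝 0) := by
    have h2top : (2 : ℝ≥0∞) ^ (p - 1) ≠ ∞ :=
      (ENNReal.rpow_lt_top_of_nonneg (by linarith) (by simp)).ne
    rw [ENNReal.tendsto_nhds_zero]
    intro η hη
    -- The factor `4` counts an inner part and a tail for each of the two remainders; `ε ^ p` pays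
    -- for transport inside the cells.
    obtain ⟨ε, hε0, hε⟩ : ∃ ε : ℝ, 0 < ε ∧
        2 ^ (p - 1) * (ENNReal.ofReal ε * 4) + ENNReal.ofReal ε ^ p ≤ η := by
      have h1 : Tendsto (fun ε : ℝ => (2 : ℝ≥0∞) ^ (p - 1) * (ENNReal.ofReal ε * 4) +
          ENNReal.ofReal ε ^ p) (𝓝[>] 0) (𝓝 (2 ^ (p - 1) * (ENNReal.ofReal 0 * 4) +
          ENNReal.ofReal 0 ^ p)) := by
        have h0 : Tendsto (fun ε : ℝ => ENNReal.ofReal ε) (𝓝[>] 0) (𝓝 (ENNReal.ofReal 0)) :=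
          (ENNReal.continuous_ofReal.tendsto 0).mono_left nhdsWithin_le_nhds
        exact (ENNReal.Tendsto.const_mul (ENNReal.Tendsto.mul_const h0 (Or.inr (by simp)))
          (Or.inr h2top)).add ((ENNReal.continuous_rpow_const.tendsto _).comp h0)
      simp only [ENNReal.ofReal_zero, zero_mul, mul_zero, ENNReal.zero_rpow_of_pos hp0,
        add_zero] at h1
      obtain ⟨ε, hε, hpos⟩ := ((h1.eventually (ge_mem_nhds hη)).and self_mem_nhdsWithin).exists
      exact ⟨ε, hpos, hε⟩
    obtain ⟨R, hRμ, hRν⟩ := hui (ENNReal.ofReal ε) (by simpa using hε0)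
    obtain ⟨δ, hδ0, hδ⟩ : ∃ δ : ℝ≥0∞, 0 < δ ∧ (R : ℝ≥0∞) ^ p * δ ≤ ENNReal.ofReal ε := by
      have hR : (R : ℝ≥0∞) ^ p ≠ ∞ :=
        (ENNReal.rpow_lt_top_of_nonneg hp0.le ENNReal.coe_ne_top).ne
      refine ⟨ENNReal.ofReal ε / (R : ℝ≥0∞) ^ p,
        ENNReal.div_pos (by simpa using hε0) hR, ENNReal.mul_div_le⟩
    obtain ⟨A, hAm, hAf, hAd, hAu, hAε⟩ := exists_partition_null_frontier ν.toMeasure hε0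
    have hsum : Tendsto (fun N => ∑ n ∈ Finset.range N, ν.toMeasure (A n)) atTop (𝓝 1) := by
      have := (ENNReal.summable (f := fun n => ν.toMeasure (A n))).hasSum.tendsto_sum_nat
      rwa [← measure_iUnion hAd hAm, hAu, measure_univ] at this
    obtain ⟨N, hN⟩ : ∃ N, 1 - δ < ∑ n ∈ Finset.range N, ν.toMeasure (A n) :=
      (hsum.eventually (lt_mem_nhds (ENNReal.sub_lt_self ENNReal.one_ne_top one_ne_zero
        hδ0.ne'))).exists
    -- Cells with `ν`-null boundary have converging masses, so the matched mass on the first `N`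
    -- cells eventually exceeds `1 - δ` and both remainders have mass at most `δ`.
    have hmin : Tendsto (fun i => ∑ n ∈ Finset.range N,
        min ((μ i).toMeasure (A n)) (ν.toMeasure (A n))) l
        (𝓝 (∑ n ∈ Finset.range N, ν.toMeasure (A n))) := by
      refine tendsto_finsetSum _ fun n _ => ?_
      have : Tendsto (fun i => min ((μ i).toMeasure (A n)) (ν.toMeasure (A n))) l
          (𝓝 (min (ν.toMeasure (A n)) (ν.toMeasure (A n)))) :=
        (ProbabilityMeasure.tendsto_measure_of_null_frontier_of_tendsto' hlim
          (hAf n)).min tendsto_const_nhds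
      rwa [min_self] at this
    filter_upwards [hRμ, hmin.eventually (lt_mem_nhds hN)] with i hi1 hi2
    obtain ⟨ρ, ρ', hρ, hρ', hm, hm', hc⟩ := exists_transportCost_le hp (μ i).toMeasure
      ν.toMeasure (Finset.range N) hAm (fun m _ n _ hmn => hAd hmn) hAε
    have hδle : ∀ {m S : ℝ≥0∞}, m + S = 1 → 1 - δ < S → m ≤ δ := by
      intro m S h1 h2
      have h3 : (1 : ℝ≥0∞) ≤ δ + S := by
        rw [add_comm]; exact tsub_le_iff_right.1 h2.le
      have hS : S ≠ ∞ := ne_top_of_le_ne_top ENNReal.one_ne_top (h1 ▸ le_add_self)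
      rw [← h1] at h3
      exact (ENNReal.add_le_add_iff_right hS).1 h3
    refine hc.trans (le_trans ?_ hε)
    gcongr
    have e1 := lintegral_enorm_rpow_le_of_le hp0.le hρ R
    have e2 := lintegral_enorm_rpow_le_of_le hp0.le hρ' R
    have f1 : (R : ℝ≥0∞) ^ p * ρ univ ≤ ENNReal.ofReal ε :=
      (mul_le_mul_right (hδle hm hi2) _).trans hδ
    have f2 : (R : ℝ≥0∞) ^ p * ρ' univ ≤ ENNReal.ofReal ε :=
      (mul_le_mul_right (hδle hm' hi2) _).trans hδ
    calc ∫⁻ x, ‖x‖ₑ ^ p ∂ρ + ∫⁻ x, ‖x‖ₑ ^ p ∂ρ'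
        ≤ (ENNReal.ofReal ε + ENNReal.ofReal ε) + (ENNReal.ofReal ε + ENNReal.ofReal ε) :=
          add_le_add (e1.trans (add_le_add f1 hi1)) (e2.trans (add_le_add f2 hRν))
      _ = _ := by ring
  have h1 : Tendsto (fun i => transportCost p (μ i).toMeasure ν.toMeasure ^ (1 / p)) l (𝓝 0) := by
    have := (ENNReal.continuous_rpow_const (y := 1 / p)).tendsto 0 |>.comp hcost
    rwa [ENNReal.zero_rpow_of_pos (by positivity)] at this
  simpa [Wp_eq, Function.comp_def] using (ENNReal.tendsto_toReal ENNReal.zero_ne_top).comp h1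

/-! ### Damped moment weights and their cutoffs as test functions. -/

/-- The weight `1 + ‖x‖²`. -/
def weight {d : ℕ} (x : Rd d) : ℝ := 1 + ‖x‖ ^ 2

lemma one_le_weight {d : ℕ} (x : Rd d) : 1 ≤ weight x := by
  unfold weight; nlinarith [sq_nonneg ‖x‖]

lemma weight_pos {d : ℕ} (x : Rd d) : 0 < weight x := zero_lt_one.trans_le (one_le_weight x)

lemma norm_le_weight {d : ℕ} (x : Rd d) : ‖x‖ ≤ weight x := by
  unfold weight; nlinarith [sq_nonneg (‖x‖ - 1)]

lemma contDiff_weight {d : ℕ} : ContDiff ℝ 1 (weight : Rd d → ℝ) :=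
  contDiff_const.add (contDiff_norm_sq ℝ)

lemma continuous_weight {d : ℕ} : Continuous (weight : Rd d → ℝ) := contDiff_weight.continuous

lemma hasFDerivAt_weight {d : ℕ} (x : Rd d) :
    HasFDerivAt (weight : Rd d → ℝ) (2 • innerSL ℝ x) x :=
  (hasStrictFDerivAt_norm_sq x).hasFDerivAt.const_add 1

/-- The weight of the `p`-moment, damped on the region where `1 + ‖x‖²` is below `lam`. -/
def momentFn {d : ℕ} (p lam : ℝ) (x : Rd d) : ℝ :=
  weight x ^ (p / 2) * (weight x / (lam + weight x))

lemma momentFn_nonneg {d : ℕ} {p lam : ℝ} (hl : 0 ≤ lam) (x : Rd d) : 0 ≤ momentFn p lam x := by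
  have := weight_pos x
  unfold momentFn; positivity

lemma momentFn_zero {d : ℕ} (p : ℝ) (x : Rd d) : momentFn p 0 x = weight x ^ (p / 2) := by
  have := (weight_pos x).ne'
  simp [momentFn, this]

lemma momentFn_le {d : ℕ} {p lam : ℝ} (hl : 0 ≤ lam) (x : Rd d) :
    momentFn p lam x ≤ weight x ^ (p / 2) := by
  have := weight_pos x
  refine mul_le_of_le_one_right (by positivity) ?_
  rw [div_le_one (by positivity)]; linarith

lemma continuous_momentFn {d : ℕ} {p lam : ℝ} (hl : 0 ≤ lam) :
    Continuous (momentFn p lam : Rd d → ℝ) := by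
  have h : ∀ x : Rd d, weight x ≠ 0 := fun x => (weight_pos x).ne'
  have h' : ∀ x : Rd d, lam + weight x ≠ 0 := fun x => by have := weight_pos x; positivity
  exact (continuous_weight.rpow_const fun x => Or.inl (h x)).mul
    (continuous_weight.div (continuous_const.add continuous_weight) h')

lemma hasDerivAt_max_zero_sq (s : ℝ) :
    HasDerivAt (fun s : ℝ => (max 0 s) ^ 2) (2 * max 0 s) s := by
  rcases lt_trichotomy s 0 with h | rfl | h
  · have : (fun s : ℝ => (max 0 s) ^ 2) =ᶠ[𝓝 s] fun _ => 0 := by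
      filter_upwards [Iio_mem_nhds h] with y hy
      simp [max_eq_left (le_of_lt (Set.mem_Iio.mp hy))]
    simpa [max_eq_left h.le] using (hasDerivAt_const s (0 : ℝ)).congr_of_eventuallyEq this
  · rw [hasDerivAt_iff_isLittleO]
    simp only [max_self, mul_zero, smul_zero, sub_zero, ne_eq, OfNat.ofNat_ne_zero,
      not_false_eq_true, zero_pow]
    refine Asymptotics.IsBigO.trans_isLittleO (g := fun y : ℝ => y ^ 2) ?_ ?_
    · refine Asymptotics.IsBigO.of_bound 1 (Eventually.of_forall fun y => ?_)
      rw [one_mul, Real.norm_of_nonneg (sq_nonneg _), Real.norm_of_nonneg (sq_nonneg _)]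
      rcases le_total y 0 with h | h
      · simp [max_eq_left h, sq_nonneg]
      · simp [max_eq_right h]
    · simpa using Asymptotics.isLittleO_pow_id (𝕜 := ℝ) (n := 2) (by norm_num)
  · have : (fun s : ℝ => (max 0 s) ^ 2) =ᶠ[𝓝 s] fun y => y ^ 2 := by
      filter_upwards [Ioi_mem_nhds h] with y hy
      simp [max_eq_right (le_of_lt (Set.mem_Ioi.mp hy))]
    simpa [max_eq_right h.le] using (hasDerivAt_pow 2 s).congr_of_eventuallyEq this

/-- Squaring the positive part removes its corner; first-order smoothness suffices for a test
function in the continuity equation. -/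
lemma contDiff_max_zero_sq : ContDiff ℝ 1 (fun s : ℝ => (max 0 s) ^ 2) := by
  rw [contDiff_one_iff_deriv]
  refine ⟨fun s => (hasDerivAt_max_zero_sq s).differentiableAt, ?_⟩
  rw [funext fun s => (hasDerivAt_max_zero_sq s).deriv]
  fun_prop

/-- The cutoff `(1 - (1 + ‖x‖²) / k)₊²` of the weight at level `k`. -/
def cutoff {d : ℕ} (k : ℝ) (x : Rd d) : ℝ := (max 0 (1 - weight x / k)) ^ 2

lemma cutoff_nonneg {d : ℕ} (k : ℝ) (x : Rd d) : 0 ≤ cutoff k x := sq_nonneg _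

lemma cutoff_le_one {d : ℕ} {k : ℝ} (hk : 0 < k) (x : Rd d) : cutoff k x ≤ 1 := by
  have : 0 ≤ weight x / k := div_nonneg (weight_pos x).le hk.le
  exact pow_le_one₀ (le_max_left _ _) (max_le zero_le_one (by linarith))

lemma tendsto_cutoff {d : ℕ} (x : Rd d) : Tendsto (fun k : ℕ => cutoff (k : ℝ) x) atTop (𝓝 1) := by
  have h : Tendsto (fun k : ℕ => weight x / (k : ℝ)) atTop (𝓝 0) :=
    tendsto_const_div_atTop_nhds_zero_nat _
  have h2 := ((tendsto_const_nhds (x := (0 : ℝ))).max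
    ((tendsto_const_nhds (x := (1 : ℝ))).sub h)).pow 2
  simpa [cutoff] using h2

lemma contDiff_momentFn_mul_cutoff {d : ℕ} {p lam : ℝ} (hl : 0 ≤ lam) (k : ℝ) :
    ContDiff ℝ 1 (fun x : Rd d => momentFn p lam x * cutoff k x) := by
  have h : ∀ x : Rd d, weight x ≠ 0 := fun x => (weight_pos x).ne'
  have h' : ∀ x : Rd d, lam + weight x ≠ 0 := fun x => by have := weight_pos x; positivity
  refine ContDiff.mul (ContDiff.mul (contDiff_weight.rpow_const_of_ne h)
    (contDiff_weight.div (contDiff_const.add contDiff_weight) h')) ?_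
  exact contDiff_max_zero_sq.comp (contDiff_const.sub (contDiff_weight.div_const k))

lemma hasCompactSupport_mul_cutoff {d : ℕ} (f : Rd d → ℝ) {k : ℝ} (hk : 0 < k) :
    HasCompactSupport (fun x : Rd d => f x * cutoff k x) := by
  refine HasCompactSupport.of_support_subset_isCompact (isCompact_closedBall (0 : Rd d) k) ?_
  intro x hx
  by_contra hx'
  apply hx
  have h1 : k < ‖x‖ := by simpa using hx'
  have h2 : 1 < weight x / k := by
    rw [one_lt_div hk]; exact h1.trans_le (norm_le_weight x)
  simp [cutoff, max_eq_left (by linarith : 1 - weight x / k ≤ 0)]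

lemma hasDerivAt_profile {p lam k s : ℝ} (hl : 0 ≤ lam) (hs : 0 < s) :
    HasDerivAt (fun s : ℝ => s ^ (p / 2) * (s / (lam + s)) * (max 0 (1 - s / k)) ^ 2)
      (((p / 2 * s ^ (p / 2 - 1)) * (s / (lam + s)) + s ^ (p / 2) * (lam / (lam + s) ^ 2)) *
        (max 0 (1 - s / k)) ^ 2 +
        s ^ (p / 2) * (s / (lam + s)) * (2 * max 0 (1 - s / k) * (-(1 / k)))) s := by
  have h1 : HasDerivAt (fun s : ℝ => s ^ (p / 2)) (p / 2 * s ^ (p / 2 - 1)) s :=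
    Real.hasDerivAt_rpow_const (Or.inl hs.ne')
  have h2 : HasDerivAt (fun s : ℝ => s / (lam + s)) (lam / (lam + s) ^ 2) s := by
    have := (hasDerivAt_id' s).div ((hasDerivAt_id' s).const_add lam) (by positivity)
    refine this.congr_deriv ?_
    congr 1
    ring
  have h3 : HasDerivAt (fun s : ℝ => (max 0 (1 - s / k)) ^ 2)
      (2 * max 0 (1 - s / k) * (-(1 / k))) s :=
    HasDerivAt.comp (h₂ := fun s : ℝ => (max 0 s) ^ 2) s (hasDerivAt_max_zero_sq (1 - s / k))
      (((hasDerivAt_id' s).div_const k).const_sub 1)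
  exact (h1.mul h2).mul h3

/-- The point is uniformity in `k` and `lam`. Multiplied by `s`, the power contributes at most `p /
2`, the damping factor `lam / (lam + s) ≤ 1`, and the cutoff at most `2`, because `m * (s / k)` has
the form `(1 - u) * u` wherever the cutoff is nonzero. -/
lemma abs_profile_deriv_mul_le {p lam k s : ℝ} (hp : 0 ≤ p) (hl : 0 ≤ lam) (hk : 0 < k)
    (hs : 0 < s) :
    |((p / 2 * s ^ (p / 2 - 1)) * (s / (lam + s)) + s ^ (p / 2) * (lam / (lam + s) ^ 2)) *
        (max 0 (1 - s / k)) ^ 2 +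
        s ^ (p / 2) * (s / (lam + s)) * (2 * max 0 (1 - s / k) * (-(1 / k)))| * s ≤
      (p / 2 + 3) * (s ^ (p / 2) * (s / (lam + s))) := by
  set m := max 0 (1 - s / k) with hm
  have hm0 : 0 ≤ m := le_max_left _ _
  have hsk : 0 < s / k := by positivity
  have hm1 : m ≤ 1 := max_le zero_le_one (by linarith)
  have hms : m * (s / k) ≤ 1 := by
    rcases le_total (1 - s / k) 0 with h | h
    · simp [hm, max_eq_left h]
    · rw [hm, max_eq_right h]; nlinarith
  set A := s ^ (p / 2) * (s / (lam + s)) with hA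
  have hA0 : 0 ≤ A := by positivity
  have e1 : s ^ (p / 2 - 1) * s = s ^ (p / 2) := by
    rw [← Real.rpow_add_one hs.ne']; congr 1; ring
  have hq : lam / (lam + s) ≤ 1 := by rw [div_le_one (by positivity)]; linarith
  have hq0 : 0 ≤ lam / (lam + s) := by positivity
  have e : (((p / 2 * s ^ (p / 2 - 1)) * (s / (lam + s)) + s ^ (p / 2) * (lam / (lam + s) ^ 2)) *
        m ^ 2 + A * (2 * m * (-(1 / k)))) * s =
      A * ((p / 2 + lam / (lam + s)) * m ^ 2 - 2 * (m * (s / k))) := by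
    have hne : lam + s ≠ 0 := by positivity
    calc _ = ((p / 2 * (s ^ (p / 2 - 1) * s)) * (s / (lam + s)) +
          s ^ (p / 2) * (s / (lam + s)) * (lam / (lam + s))) * m ^ 2
          - A * (2 * (m * (s / k))) := by field_simp; ring
      _ = _ := by rw [e1, hA]; ring
  rw [← abs_of_pos hs, ← abs_mul, abs_of_pos hs, e, abs_mul, abs_of_nonneg hA0, mul_comm _ A]
  refine mul_le_mul_of_nonneg_left ?_ hA0
  have hm2 : m ^ 2 ≤ 1 := pow_le_one₀ hm0 hm1
  have h0 : 0 ≤ m * (s / k) := by positivity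
  have h1 : 0 ≤ (p / 2 + lam / (lam + s)) * m ^ 2 := by positivity
  have h2 : (p / 2 + lam / (lam + s)) * m ^ 2 ≤ p / 2 + lam / (lam + s) :=
    mul_le_of_le_one_right (by positivity) hm2
  rw [abs_le]; constructor <;> linarith

lemma inner_gradient_eq_fderiv {d : ℕ} (f : Rd d → ℝ) (x v : Rd d) :
    inner ℝ (gradient f x) v = fderiv ℝ f x v := by
  rw [gradient, InnerProductSpace.toDual_symm_apply]

/-- The test function is a radial profile evaluated at `weight x`, whose gradient is `2 x`; hence `p
+ 6 = 2 * (p / 2 + 3)`. The bound contains no trace of the cutoff, so it survives `k → ∞`. -/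
lemma abs_inner_gradient_momentFn_mul_cutoff_le {d : ℕ} {p lam k : ℝ} (hp : 0 ≤ p) (hl : 0 ≤ lam)
    (hk : 0 < k) (x v : Rd d) :
    |inner ℝ (gradient (fun x : Rd d => momentFn p lam x * cutoff k x) x) v| ≤
      (p + 6) * momentFn p lam x * (‖x‖ * ‖v‖ / weight x) := by
  have hw := weight_pos x
  have h := (hasDerivAt_profile (p := p) (k := k) hl hw).comp_hasFDerivAt x (hasFDerivAt_weight x)
  have hb := abs_profile_deriv_mul_le hp hl hk hw
  rw [inner_gradient_eq_fderiv]
  have h' : HasFDerivAt (fun x : Rd d => momentFn p lam x * cutoff k x) _ x := h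
  rw [h'.fderiv]
  set D := ((p / 2 * weight x ^ (p / 2 - 1)) * (weight x / (lam + weight x)) +
    weight x ^ (p / 2) * (lam / (lam + weight x) ^ 2)) * (max 0 (1 - weight x / k)) ^ 2 +
    weight x ^ (p / 2) * (weight x / (lam + weight x)) *
      (2 * max 0 (1 - weight x / k) * (-(1 / k))) with hD
  have hval : (D • ((2 : ℕ) • innerSL ℝ x : Rd d →L[ℝ] ℝ)) v = 2 * D * inner ℝ x v := by
    simp; ring
  rw [hval, abs_mul, abs_mul, abs_two]
  have hin : |inner ℝ x v| ≤ ‖x‖ * ‖v‖ := abs_real_inner_le_norm x v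
  have hb' : |D| ≤ (p / 2 + 3) * momentFn p lam x / weight x := by
    rw [le_div_iff₀ hw]; exact hb
  have := momentFn_nonneg (p := p) hl x
  calc 2 * |D| * |inner ℝ x v| ≤ 2 * ((p / 2 + 3) * momentFn p lam x / weight x) * (‖x‖ * ‖v‖) := by
        gcongr
    _ = _ := by ring

/-! ### A Grönwall inequality for limits of absolutely continuous functions. -/

lemma abs_sub_le_integral_of_absolutelyContinuous {f f' g : ℝ → ℝ} {a b : ℝ} (hab : a ≤ b)
    (hf : AbsolutelyContinuousOnInterval f a b)
    (hf' : ∀ᵐ t ∂(volume.restrict (Icc a b)), HasDerivAt f (f' t) t)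
    (hg : IntervalIntegrable g volume a b)
    (hfg : ∀ᵐ t ∂(volume.restrict (Icc a b)), |f' t| ≤ g t) :
    |f b - f a| ≤ ∫ t in a..b, g t := by
  rw [← hf.integral_deriv_eq_sub]
  have hae : ∀ᵐ t ∂(volume.restrict (Icc a b)), ‖deriv f t‖ ≤ g t := by
    filter_upwards [hf', hfg] with t h1 h2
    rwa [h1.deriv]
  rw [ae_restrict_iff' measurableSet_Icc] at hae
  exact intervalIntegral.norm_integral_le_of_norm_le hab
    (hae.mono fun t ht h => ht (Ioc_subset_Icc_self h)) hg

/-- Grönwall's inequality for a pointwise limit of absolutely continuous functions. -/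
lemma le_mul_exp_of_tendsto_absolutelyContinuous {f f' : ℕ → ℝ → ℝ} {M : ℝ → ℝ} {a b C K : ℝ}
    (hab : a ≤ b) (hC : 0 ≤ C) (hM0 : ∀ t ∈ Icc a b, 0 ≤ M t) (hMK : ∀ t ∈ Icc a b, M t ≤ K)
    (hlim : ∀ t ∈ Icc a b, Tendsto (fun k => f k t) atTop (𝓝 (M t)))
    (hf : ∀ k, AbsolutelyContinuousOnInterval (f k) a b)
    (hf' : ∀ k, ∀ᵐ t ∂(volume.restrict (Icc a b)), HasDerivAt (f k) (f' k t) t)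
    (hfM : ∀ k, ∀ᵐ t ∂(volume.restrict (Icc a b)), |f' k t| ≤ C * M t) :
    M b ≤ M a * Real.exp (C * (b - a)) := by
  have hK : 0 ≤ K := (hM0 a (left_mem_Icc.2 hab)).trans (hMK a (left_mem_Icc.2 hab))
  -- The increment bound passes to the limit in `k`. An integrable majorant `g` stands in for `C *
  -- M`, since `M` is so far only a pointwise limit.
  have sub : ∀ {s t : ℝ}, s ∈ Icc a b → t ∈ Icc a b → s ≤ t → ∀ g : ℝ → ℝ,
      IntervalIntegrable g volume s t →
      (∀ u ∈ Icc a b, C * M u ≤ g u) → |M t - M s| ≤ ∫ u in s..t, g u := by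
    intro s t hs ht hst g hg hMg
    refine le_of_tendsto ((hlim t ht).sub (hlim s hs)).abs (Eventually.of_forall fun k => ?_)
    have hsub : Icc s t ⊆ Icc a b := Icc_subset_Icc hs.1 ht.2
    refine abs_sub_le_integral_of_absolutelyContinuous hst
      ((hf k).mono (by rwa [uIcc_of_le hst, uIcc_of_le hab]))
      (ae_restrict_of_ae_restrict_of_subset hsub (hf' k)) hg ?_
    filter_upwards [ae_restrict_of_ae_restrict_of_subset hsub (hfM k),
      ae_restrict_mem measurableSet_Icc] with u h1 h2
    exact h1.trans (hMg u (hsub h2))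
  -- The crude majorant `C * K` makes `M` Lipschitz, hence continuous, after which `C * M` itself is
  -- an admissible majorant.
  have hLip : LipschitzOnWith (C * K).toNNReal M (Icc a b) := by
    refine LipschitzOnWith.of_dist_le_mul fun s hs t ht => ?_
    rw [Real.coe_toNNReal _ (by positivity)]
    have key : ∀ s ∈ Icc a b, ∀ t ∈ Icc a b, s ≤ t → |M t - M s| ≤ C * K * |t - s| := by
      intro s hs t ht hst
      have := sub hs ht hst (fun _ => C * K) (by simp)
        (fun u hu => mul_le_mul_of_nonneg_left (hMK u hu) hC)
      rw [intervalIntegral.integral_const, smul_eq_mul] at this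
      rw [abs_of_nonneg (sub_nonneg.2 hst)]; linarith
    rcases le_total s t with h | h
    · rw [dist_comm, dist_comm s t]; exact key s hs t ht h
    · exact key t ht s hs h
  have hcont : ContinuousOn M (Icc a b) := hLip.continuousOn
  set N : ℝ → ℝ := IccExtend hab ((Icc a b).domRestrict M) with hN
  have hNc : Continuous N := hcont.domRestrict.Icc_extend'
  have hNM : ∀ t ∈ Icc a b, N t = M t := fun t ht => by
    rw [hN, IccExtend_of_mem hab _ ht]; rfl
  have hCN : Continuous fun u => C * N u := continuous_const.mul hNc
  -- Differential Grönwall is applied to the `C¹` function `G ≥ M`, as `M` need not be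
  -- differentiable.
  set G : ℝ → ℝ := fun t => M a + ∫ u in a..t, C * N u with hG
  have hG' : ∀ t, HasDerivAt G (C * N t) t := fun t =>
    (intervalIntegral.integral_hasDerivAt_right (hCN.intervalIntegrable _ _)
      (hCN.stronglyMeasurableAtFilter _ _) hCN.continuousAt).const_add _
  have hMG : ∀ t ∈ Icc a b, M t ≤ G t := by
    intro t ht
    have := sub (left_mem_Icc.2 hab) ht ht.1 (fun u => C * N u) (hCN.intervalIntegrable _ _)
      (fun u hu => by rw [hNM u hu])
    have h2 := le_abs_self (M t - M a)
    simp only [hG]; linarith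
  have hGb := norm_le_gronwallBound_of_norm_deriv_right_le (f := G) (f' := fun t => C * N t)
    (δ := M a) (K := C) (ε := 0) (a := a) (b := b)
    (fun t _ => (hG' t).continuousAt.continuousWithinAt) (fun t _ => (hG' t).hasDerivWithinAt)
    (by simp [hG, abs_of_nonneg (hM0 a (left_mem_Icc.2 hab))])
    (fun t ht => by
      have ht' := Ico_subset_Icc_self ht
      rw [norm_mul, Real.norm_of_nonneg hC, add_zero]
      refine mul_le_mul_of_nonneg_left ?_ hC
      rw [hNM t ht', Real.norm_of_nonneg (hM0 t ht')]
      exact (hMG t ht').trans (le_abs_self _)) b (right_mem_Icc.2 hab)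
  rw [gronwallBound_ε0] at hGb
  exact (hMG b (right_mem_Icc.2 hab)).trans ((le_abs_self _).trans hGb)

/-! ### Moments of measures and their growth along trajectories. -/

lemma norm_rpow_le_weight {d : ℕ} {p : ℝ} (hp : 0 ≤ p) (x : Rd d) :
    ‖x‖ ^ p ≤ weight x ^ (p / 2) := by
  have h : ‖x‖ ^ p = (‖x‖ ^ 2) ^ (p / 2) := by
    rw [← Real.rpow_natCast, ← Real.rpow_mul (norm_nonneg _)]; congr 1; push_cast; ring
  rw [h]
  refine Real.rpow_le_rpow (sq_nonneg _) ?_ (by linarith)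
  unfold weight; linarith

lemma weight_rpow_le {d : ℕ} {p : ℝ} (hp : 0 ≤ p) (x : Rd d) :
    weight x ^ (p / 2) ≤ 2 ^ (p / 2) * (1 + ‖x‖ ^ p) := by
  have h : ‖x‖ ^ p = (‖x‖ ^ 2) ^ (p / 2) := by
    rw [← Real.rpow_natCast, ← Real.rpow_mul (norm_nonneg _)]; congr 1; push_cast; ring
  have hw : weight x ≤ 2 * max 1 (‖x‖ ^ 2) := by
    unfold weight; linarith [le_max_left 1 (‖x‖ ^ 2), le_max_right 1 (‖x‖ ^ 2)]
  refine (Real.rpow_le_rpow (weight_pos x).le hw (by linarith)).trans ?_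
  rw [Real.mul_rpow (by norm_num) (by positivity)]
  refine mul_le_mul_of_nonneg_left ?_ (by positivity)
  rcases le_total 1 (‖x‖ ^ 2) with h1 | h1
  · rw [max_eq_right h1, h]; linarith
  · rw [max_eq_left h1, Real.one_rpow]
    have : 0 ≤ ‖x‖ ^ p := by positivity
    linarith

lemma ofReal_norm_rpow {d : ℕ} {p : ℝ} (hp : 0 ≤ p) (x : Rd d) :
    ENNReal.ofReal (‖x‖ ^ p) = ‖x‖ₑ ^ p := by
  rw [← ENNReal.ofReal_rpow_of_nonneg (norm_nonneg x) hp, ofReal_norm]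

lemma integrable_norm_rpow {d : ℕ} {p : ℝ} (hp : 0 ≤ p) (μ : Pp d p) :
    Integrable (fun x => ‖x‖ ^ p) μ.toMeasure := by
  refine ⟨(by fun_prop : Measurable fun x : Rd d => ‖x‖ ^ p).aestronglyMeasurable, ?_⟩
  rw [hasFiniteIntegral_iff_ofReal (Eventually.of_forall fun x => by positivity)]
  simp_rw [ofReal_norm_rpow hp]
  exact μ.lintegral_lt_top

lemma integrable_weight_rpow {d : ℕ} {p : ℝ} (hp : 0 ≤ p) (μ : Pp d p) :
    Integrable (fun x => weight x ^ (p / 2)) μ.toMeasure := by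
  refine Integrable.mono' (((integrable_const 1).add (integrable_norm_rpow hp μ)).const_mul
    (2 ^ (p / 2))) ?_ (Eventually.of_forall fun x => ?_)
  · exact (continuous_weight.rpow_const fun x => Or.inl (weight_pos x).ne').aestronglyMeasurable
  · rw [Real.norm_of_nonneg (Real.rpow_nonneg (weight_pos x).le _)]
    exact weight_rpow_le hp x

/-- The integral of `momentFn`. -/
def moment {d : ℕ} {p : ℝ} (lam : ℝ) (μ : Pp d p) : ℝ := ∫ x, momentFn p lam x ∂μ.toMeasure

lemma integrable_momentFn {d : ℕ} {p lam : ℝ} (hp : 0 ≤ p) (hl : 0 ≤ lam) (μ : Pp d p) :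
    Integrable (momentFn p lam) μ.toMeasure := by
  refine (integrable_weight_rpow hp μ).mono' (continuous_momentFn hl).aestronglyMeasurable
    (Eventually.of_forall fun x => ?_)
  rw [Real.norm_of_nonneg (momentFn_nonneg hl x)]
  exact momentFn_le hl x

lemma moment_nonneg {d : ℕ} {p lam : ℝ} (hl : 0 ≤ lam) (μ : Pp d p) : 0 ≤ moment lam μ :=
  integral_nonneg fun x => momentFn_nonneg hl x

lemma moment_zero_eq {d : ℕ} {p : ℝ} (μ : Pp d p) :
    moment 0 μ = ∫ x, weight x ^ (p / 2) ∂μ.toMeasure := by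
  simp [moment, momentFn_zero]

lemma lintegral_enorm_rpow_eq {d : ℕ} {p : ℝ} (hp : 0 ≤ p) (μ : Pp d p) :
    ∫⁻ x, ‖x‖ₑ ^ p ∂μ.toMeasure = ENNReal.ofReal (∫ x, ‖x‖ ^ p ∂μ.toMeasure) := by
  rw [ofReal_integral_eq_lintegral_ofReal (integrable_norm_rpow hp μ)
    (Eventually.of_forall fun x => by positivity)]
  simp_rw [ofReal_norm_rpow hp]

lemma integral_norm_rpow_le_moment {d : ℕ} {p : ℝ} (hp : 0 ≤ p) (μ : Pp d p) :
    ∫ x, ‖x‖ ^ p ∂μ.toMeasure ≤ moment 0 μ := by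
  rw [moment_zero_eq]
  exact integral_mono (integrable_norm_rpow hp μ) (integrable_weight_rpow hp μ)
    fun x => norm_rpow_le_weight hp x

lemma moment_le {d : ℕ} {p lam : ℝ} (hp : 0 ≤ p) (hl : 0 ≤ lam) (μ : Pp d p) :
    moment lam μ ≤ 2 ^ (p / 2) * (1 + ∫ x, ‖x‖ ^ p ∂μ.toMeasure) := by
  have h : ∫ x, 2 ^ (p / 2) * (1 + ‖x‖ ^ p) ∂μ.toMeasure =
      2 ^ (p / 2) * (1 + ∫ x, ‖x‖ ^ p ∂μ.toMeasure) := by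
    rw [integral_const_mul, integral_add (integrable_const 1) (integrable_norm_rpow hp μ)]
    simp
  rw [← h]
  exact integral_mono (integrable_momentFn hp hl μ)
    (((integrable_const 1).add (integrable_norm_rpow hp μ)).const_mul _)
    fun x => (momentFn_le hl x).trans (weight_rpow_le hp x)

lemma Wp_dirac_rpow_le_moment {d : ℕ} {p : ℝ} (hp : 0 < p) (μ : Pp d p) :
    Wp (Pp.dirac d hp) μ ^ p ≤ moment 0 μ := by
  have h0 : 0 ≤ ∫ x, ‖x‖ ^ p ∂μ.toMeasure := integral_nonneg fun x => by positivity
  have h := Wp_dirac_le hp μ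
  rw [lintegral_enorm_rpow_eq hp.le, ENNReal.ofReal_rpow_of_nonneg h0 (by positivity),
    ENNReal.toReal_ofReal (by positivity)] at h
  calc Wp (Pp.dirac d hp) μ ^ p ≤ ((∫ x, ‖x‖ ^ p ∂μ.toMeasure) ^ (1 / p)) ^ p :=
        Real.rpow_le_rpow (Wp_nonneg _ _) h hp.le
    _ = ∫ x, ‖x‖ ^ p ∂μ.toMeasure := by
        rw [← Real.rpow_mul h0, one_div_mul_cancel hp.ne', Real.rpow_one]
    _ ≤ _ := integral_norm_rpow_le_moment hp.le μ

/-- A `W_p`-continuous curve has bounded moments on compact intervals. -/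
lemma exists_moment_le {d : ℕ} {p lam a b : ℝ} (hp : 1 ≤ p) (hl : 0 ≤ lam) {θ : ℝ → Pp d p}
    (hθ : ∀ t ∈ Icc a b, Tendsto (fun s => Wp (θ s) (θ t)) (𝓝[Icc a b] t) (𝓝 0)) :
    ∃ K, ∀ t ∈ Icc a b, moment lam (θ t) ≤ K := by
  have hp0 : 0 ≤ p := by linarith
  refine (isCompact_Icc : IsCompact (Icc a b)).induction_on
    (p := fun S => ∃ K, ∀ t ∈ S, moment lam (θ t) ≤ K) ⟨0, by simp⟩ ?_ ?_ ?_
  · rintro S S' hSS' ⟨K, hK⟩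
    exact ⟨K, fun t ht => hK t (hSS' ht)⟩
  · rintro S S' ⟨K, hK⟩ ⟨K', hK'⟩
    refine ⟨max K K', ?_⟩
    rintro t (ht | ht)
    · exact (hK t ht).trans (le_max_left _ _)
    · exact (hK' t ht).trans (le_max_right _ _)
  · intro t ht
    refine ⟨_, (hθ t ht).eventually (gt_mem_nhds one_pos),
      2 ^ (p / 2) * (1 + 2 ^ (p - 1) * (1 + ∫ x, ‖x‖ ^ p ∂(θ t).toMeasure)), fun s hs => ?_⟩
    refine (moment_le hp0 hl _).trans ?_
    gcongr
    have h := lintegral_enorm_rpow_le_of_Wp_lt_one hp (show Wp (θ s) (θ t) < 1 from hs)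
    have h0 : 0 ≤ ∫ x, ‖x‖ ^ p ∂(θ t).toMeasure := integral_nonneg fun x => by positivity
    have h2 : (2 : ℝ≥0∞) ^ (p - 1) = ENNReal.ofReal (2 ^ (p - 1)) := by
      rw [← ENNReal.ofReal_rpow_of_pos two_pos, ENNReal.ofReal_ofNat]
    rw [lintegral_enorm_rpow_eq hp0, lintegral_enorm_rpow_eq hp0, ← ENNReal.ofReal_one,
      ← ENNReal.ofReal_add zero_le_one h0, h2,
      ← ENNReal.ofReal_mul (by positivity)] at h
    exact (ENNReal.ofReal_le_ofReal_iff (by positivity)).1 h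

lemma tendsto_integral_momentFn_mul_cutoff {d : ℕ} {p lam : ℝ} (hp : 0 ≤ p) (hl : 0 ≤ lam)
    (μ : Pp d p) :
    Tendsto (fun k : ℕ => ∫ x, momentFn p lam x * cutoff ((k + 1 : ℕ) : ℝ) x ∂μ.toMeasure) atTop
      (𝓝 (moment lam μ)) := by
  refine tendsto_integral_of_dominated_convergence (momentFn p lam) (fun k => ?_)
    (integrable_momentFn hp hl μ) (fun k => Eventually.of_forall fun x => ?_)
    (Eventually.of_forall fun x => ?_)
  · exact (contDiff_momentFn_mul_cutoff hl _).continuous.aestronglyMeasurable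
  · rw [Real.norm_of_nonneg (mul_nonneg (momentFn_nonneg hl x) (cutoff_nonneg _ x))]
    exact mul_le_of_le_one_right (momentFn_nonneg hl x) (cutoff_le_one (by positivity) x)
  · simpa using ((tendsto_cutoff x).comp (tendsto_add_atTop_nat 1)).const_mul (momentFn p lam x)

/-- The continuity equation is tested with `momentFn * cutoff` and the cutoff is then removed by the
limiting form of Grönwall. The integrable majorant `h` leaves room for a velocity bound depending on
both `x` and the measure. -/
lemma moment_le_mul_exp {d : ℕ} {p lam a b C : ℝ} {F : Pp d p → Rd d → Set (Rd d)}
    {θ : ℝ → Pp d p} {ν : ℝ → VectorMeasure (Rd d) (Rd d)} {v : ℝ → Rd d → Rd d}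
    (hp : 1 ≤ p) (hl : 0 ≤ lam) (hab : a ≤ b) (hC : 0 ≤ C)
    (hθ : ∀ t ∈ Icc a b, Tendsto (fun s => Wp (θ s) (θ t)) (𝓝[Icc a b] t) (𝓝 0))
    (hv : IsDrivenBy F a b θ ν v)
    (hh : ∀ᵐ t ∂(volume.restrict (Icc a b)), ∃ h : Rd d → ℝ, Integrable h (θ t).toMeasure ∧
      (∀ᵐ x ∂(θ t).toMeasure, momentFn p lam x * (‖x‖ * ‖v t x‖ / weight x) ≤ h x) ∧
      ∫ x, h x ∂(θ t).toMeasure ≤ C * moment lam (θ t)) :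
    moment lam (θ b) ≤ moment lam (θ a) * Real.exp ((p + 6) * C * (b - a)) := by
  have hp0 : 0 ≤ p := by linarith
  obtain ⟨K, hK⟩ := exists_moment_le hp hl hθ
  have hk : ∀ k : ℕ, (0 : ℝ) < ((k + 1 : ℕ) : ℝ) := fun k => by positivity
  have hce := fun k : ℕ => hv.continuityEquation
    (fun x => momentFn p lam x * cutoff ((k + 1 : ℕ) : ℝ) x)
    (contDiff_momentFn_mul_cutoff hl _) (hasCompactSupport_mul_cutoff _ (hk k))
  refine le_mul_exp_of_tendsto_absolutelyContinuous (M := fun t => moment lam (θ t))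
    (f' := fun k t => ∫ x, inner ℝ (gradient (fun x : Rd d =>
      momentFn p lam x * cutoff ((k + 1 : ℕ) : ℝ) x) x) (v t x) ∂(θ t).toMeasure) hab
    (by positivity) (fun t _ => moment_nonneg hl _) hK
    (fun t _ => tendsto_integral_momentFn_mul_cutoff hp0 hl (θ t))
    (fun k => (hce k).1) (fun k => (hce k).2) (fun k => ?_)
  filter_upwards [hh] with t ⟨h, hint, hle, hCle⟩
  rw [← Real.norm_eq_abs]
  refine (norm_integral_le_of_norm_le (hint.const_mul (p + 6)) ?_).trans ?_
  · filter_upwards [hle] with x hx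
    refine (abs_inner_gradient_momentFn_mul_cutoff_le hp0 hl (hk k) x (v t x)).trans ?_
    rw [mul_assoc]
    gcongr
  · rw [integral_const_mul, mul_assoc]
    gcongr

/-- Linear growth of the dynamics. -/
lemma exists_norm_le_of_isLipschitzDynamics {d : ℕ} {p L : ℝ} (hp : 0 < p)
    {F : Pp d p → Rd d → Set (Rd d)} (hF : IsLipschitzDynamics F L) :
    ∃ K, 0 ≤ K ∧ ∀ μ x, ∀ v ∈ F μ x, ‖v‖ ≤ K + L * Wp (Pp.dirac d hp) μ + L * ‖x‖ := by
  obtain ⟨K, hK⟩ := (hF.compact (Pp.dirac d hp) 0).isBounded.exists_norm_le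
  refine ⟨max K 0, le_max_right _ _, fun μ x v hv => ?_⟩
  obtain ⟨u, hu, z, hz, rfl⟩ := hF.lipschitz (Pp.dirac d hp) 0 μ x hv
  obtain ⟨y, hy, rfl⟩ := hz
  have hy' : ‖y‖ ≤ 1 := by simpa using hy
  have hc : 0 ≤ L * (Wp (Pp.dirac d hp) μ + dist 0 x) :=
    mul_nonneg hF.pos.le (add_nonneg (Wp_nonneg _ _) dist_nonneg)
  calc ‖u + (L * (Wp (Pp.dirac d hp) μ + dist 0 x)) • y‖
      ≤ ‖u‖ + L * (Wp (Pp.dirac d hp) μ + dist 0 x) * ‖y‖ := by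
        refine (norm_add_le _ _).trans ?_
        rw [norm_smul, Real.norm_of_nonneg hc]
    _ ≤ max K 0 + L * (Wp (Pp.dirac d hp) μ + dist 0 x) * 1 := by
        gcongr
        exact (hK u hu).trans (le_max_left _ _)
    _ = _ := by rw [dist_zero_left]; ring

lemma norm_mul_div_weight_le {d : ℕ} {B L : ℝ} (hB : 0 ≤ B) (hL : 0 ≤ L) (x v : Rd d)
    (hv : ‖v‖ ≤ B + L * ‖x‖) : ‖x‖ * ‖v‖ / weight x ≤ B + L := by
  have hw := weight_pos x
  rw [div_le_iff₀ hw]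
  have h1 := norm_le_weight x
  have h2 : ‖x‖ ^ 2 ≤ weight x := by unfold weight; linarith
  calc ‖x‖ * ‖v‖ ≤ ‖x‖ * (B + L * ‖x‖) := by gcongr
    _ = B * ‖x‖ + L * ‖x‖ ^ 2 := by ring
    _ ≤ B * weight x + L * weight x := by gcongr
    _ = _ := by ring

/-- Young's inequality in the form needed for the growth of the moments. -/
lemma weight_rpow_mul_norm_le {d : ℕ} {p m : ℝ} (hp : 1 ≤ p) (hm : 0 ≤ m) (x : Rd d) :
    weight x ^ (p / 2) * (m * ‖x‖ / weight x) ≤ m ^ p + weight x ^ (p / 2) := by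
  have hw := weight_pos x
  set s := weight x ^ (1 / 2 : ℝ) with hs
  have hs0 : 0 < s := by positivity
  have hws : weight x = s ^ 2 := by
    rw [hs, ← Real.rpow_natCast, ← Real.rpow_mul hw.le]; norm_num
  have hwp : weight x ^ (p / 2) = s ^ p := by
    rw [hs, ← Real.rpow_mul hw.le]; congr 1; ring
  have hxs : ‖x‖ ≤ s := by
    refine le_of_sq_le_sq ?_ hs0.le
    rw [← hws]; unfold weight; linarith
  have h1 : m * ‖x‖ / weight x ≤ m / s := by
    rw [hws, div_le_div_iff₀ (by positivity) hs0]
    nlinarith [mul_le_mul_of_nonneg_left hxs (mul_nonneg hm hs0.le)]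
  rw [hwp]
  refine (mul_le_mul_of_nonneg_left h1 (by positivity)).trans ?_
  have hmp : 0 ≤ m ^ p := by positivity
  -- In both cases `s ^ (p - 1) * m ≤ max m s ^ p`, which the sum dominates.
  rcases le_total m s with h | h
  · have : m / s ≤ 1 := (div_le_one hs0).2 h
    have : s ^ p * (m / s) ≤ s ^ p := mul_le_of_le_one_right (by positivity) this
    linarith
  · have e : s ^ p * (m / s) = s ^ (p - 1) * m := by
      rw [Real.rpow_sub_one hs0.ne']; ring
    have h3 : s ^ (p - 1) * m ≤ m ^ (p - 1) * m := by gcongr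
    have h4 : m ^ (p - 1) * m = m ^ p := by
      rw [← Real.rpow_add_one (hs0.trans_le h).ne']; congr 1; ring
    have : 0 ≤ s ^ p := by positivity
    linarith

/-- The moment of order `p` grows at most exponentially along admissible trajectories. -/
lemma exists_moment_zero_le {d : ℕ} {p L : ℝ} (hp : 1 ≤ p) {F : Pp d p → Rd d → Set (Rd d)}
    (hF : IsLipschitzDynamics F L) :
    ∃ C, 0 ≤ C ∧ ∀ (a b : ℝ) (μ : Pp d p) (θ : ℝ → Pp d p), a ≤ b →
      θ ∈ admissibleTrajectories F a b μ → moment 0 (θ b) ≤ moment 0 μ * Real.exp (C * (b - a)) := by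
  have hp0 : 0 < p := by linarith
  obtain ⟨K, hK, hv⟩ := exists_norm_le_of_isLipschitzDynamics hp0 hF
  have hL := hF.pos
  -- `p + 6` is the gradient constant. Growth in `x` gives `K + L`; growth in the measure gives `2 *
  -- L`, from Young's inequality and `Wp ^ p ≤ moment 0`.
  refine ⟨(p + 6) * (K + 3 * L), by positivity, ?_⟩
  rintro a b μ θ hab ⟨rfl, hc, ν, v, hd⟩
  refine moment_le_mul_exp hp le_rfl hab (by positivity) hc hd ?_
  filter_upwards [hd.inclusion] with t ht
  set m := Wp (Pp.dirac d hp0) (θ t)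
  have hm0 : 0 ≤ m := Wp_nonneg _ _
  have hw := integrable_weight_rpow hp0.le (θ t)
  refine ⟨fun x => (K + L) * weight x ^ (p / 2) + L * (m ^ p + weight x ^ (p / 2)),
    (hw.const_mul _).add (((integrable_const _).add hw).const_mul _), ?_, ?_⟩
  · filter_upwards [ht] with x hx
    have hvx := hv (θ t) x _ hx
    have hwx := weight_pos x
    rw [momentFn_zero]
    have h1 : ‖x‖ * ‖v t x‖ / weight x ≤ (K + L) + L * (m * ‖x‖ / weight x) := by
      have h2 := norm_le_weight x
      have h3 : ‖x‖ ^ 2 ≤ weight x := by unfold weight; linarith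
      have h4 : ‖x‖ * ‖v t x‖ ≤ ‖x‖ * (K + L * m + L * ‖x‖) := by gcongr
      rw [div_le_iff₀ hwx]
      have e : ((K + L) + L * (m * ‖x‖ / weight x)) * weight x =
        (K + L) * weight x + L * (m * ‖x‖) := by field_simp
      rw [e]
      nlinarith [mul_le_mul_of_nonneg_left h2 hK, mul_le_mul_of_nonneg_left h3 hL.le]
    calc weight x ^ (p / 2) * (‖x‖ * ‖v t x‖ / weight x)
        ≤ weight x ^ (p / 2) * ((K + L) + L * (m * ‖x‖ / weight x)) := by gcongr
      _ = (K + L) * weight x ^ (p / 2) + L * (weight x ^ (p / 2) * (m * ‖x‖ / weight x)) := by ring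
      _ ≤ _ := by gcongr; exact weight_rpow_mul_norm_le hp hm0 x
  · have h2 := Wp_dirac_rpow_le_moment hp0 (θ t)
    have h3 := moment_zero_eq (θ t)
    have h4 : ∫ x, ((K + L) * weight x ^ (p / 2) + L * (m ^ p + weight x ^ (p / 2)))
        ∂(θ t).toMeasure = (K + L) * moment 0 (θ t) + L * (m ^ p + moment 0 (θ t)) := by
      have hi : Integrable (fun x => L * (m ^ p + weight x ^ (p / 2))) (θ t).toMeasure :=
        ((integrable_const (m ^ p)).add hw).const_mul L
      rw [integral_add (hw.const_mul _) hi,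
        integral_const_mul, integral_const_mul, integral_add (integrable_const _) hw, ← h3]
      simp
    rw [h4]
    nlinarith [mul_le_mul_of_nonneg_left h2 hL.le]

/-- Propagation of the damped moments along trajectories whose `p`-moment is controlled. -/
lemma exists_moment_le_mul_exp {d : ℕ} {p L : ℝ} (hp : 1 ≤ p) {F : Pp d p → Rd d → Set (Rd d)}
    (hF : IsLipschitzDynamics F L) (R : ℝ) :
    ∃ C, 0 ≤ C ∧ ∀ (lam : ℝ), 0 ≤ lam → ∀ (a b : ℝ) (μ : Pp d p) (θ : ℝ → Pp d p), a ≤ b →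
      θ ∈ admissibleTrajectories F a b μ → (∀ t ∈ Icc a b, moment 0 (θ t) ≤ R) →
      moment lam (θ b) ≤ moment lam μ * Real.exp (C * (b - a)) := by
  have hp0 : 0 < p := by linarith
  obtain ⟨K, hK, hv⟩ := exists_norm_le_of_isLipschitzDynamics hp0 hF
  have hL := hF.pos
  -- The a priori bound on `moment 0` freezes the measure-dependent part of the velocity bound at `L
  -- * m`. The resulting rate is independent of `lam`.
  set m := (max R 0) ^ (1 / p) with hm
  have hm0 : 0 ≤ m := by positivity
  refine ⟨(p + 6) * (K + L * m + L), by positivity, ?_⟩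
  rintro lam hl a b μ θ hab ⟨rfl, hc, ν, v, hd⟩ hR
  refine moment_le_mul_exp hp hl hab (by positivity) hc hd ?_
  filter_upwards [hd.inclusion, ae_restrict_mem measurableSet_Icc] with t ht htab
  have hWm : Wp (Pp.dirac d hp0) (θ t) ≤ m := by
    rw [hm, one_div, Real.le_rpow_inv_iff_of_pos (Wp_nonneg _ _) (le_max_right _ _) hp0]
    exact (Wp_dirac_rpow_le_moment hp0 _).trans ((hR t htab).trans (le_max_left _ _))
  refine ⟨fun x => (K + L * m + L) * momentFn p lam x,
    (integrable_momentFn hp0.le hl _).const_mul _, ?_, ?_⟩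
  · filter_upwards [ht] with x hx
    rw [mul_comm _ (momentFn p lam x)]
    refine mul_le_mul_of_nonneg_left ?_ (momentFn_nonneg hl x)
    refine norm_mul_div_weight_le (by positivity) hL.le x _ ((hv (θ t) x _ hx).trans ?_)
    gcongr
  · rw [integral_const_mul]; rfl

/-! ### Restriction, translation and gluing of trajectories. -/

lemma absolutelyContinuousOnInterval_congr {f g : ℝ → ℝ} {a b : ℝ} (hab : a ≤ b)
    (hf : AbsolutelyContinuousOnInterval f a b) (h : EqOn g f (Icc a b)) :
    AbsolutelyContinuousOnInterval g a b := by
  rw [absolutelyContinuousOnInterval_iff] at hf ⊢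
  intro ε hε
  obtain ⟨δ, hδ, H⟩ := hf ε hε
  refine ⟨δ, hδ, fun E hE hEδ => ?_⟩
  refine lt_of_eq_of_lt (Finset.sum_congr rfl fun i hi => ?_) (H E hE hEδ)
  have := hE.1 i hi
  rw [uIcc_of_le hab] at this
  rw [h this.1, h this.2]

/-- Translation and gluing become identities between integrals of derivatives, which avoids
splitting families of intervals in the `ε`-`δ` definition. -/
lemma absolutelyContinuousOnInterval_of_eq_integral {f g : ℝ → ℝ} {a b : ℝ} (hab : a ≤ b)
    (hg : IntervalIntegrable g volume a b) (h : ∀ t ∈ Icc a b, f t = f a + ∫ u in a..t, g u) :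
    AbsolutelyContinuousOnInterval f a b := by
  have h1 := hg.absolutelyContinuousOnInterval_intervalIntegral (c := a) left_mem_uIcc
  have h2 : AbsolutelyContinuousOnInterval (fun _ : ℝ => f a) a b :=
    (LipschitzWith.const (f a)).lipschitzOnWith.absolutelyContinuousOnInterval
  exact absolutelyContinuousOnInterval_congr hab (h2.add h1) fun t ht => h t ht

lemma absolutelyContinuousOnInterval_trans {f : ℝ → ℝ} {a b c : ℝ} (hab : a ≤ b) (hbc : b ≤ c)
    (h1 : AbsolutelyContinuousOnInterval f a b) (h2 : AbsolutelyContinuousOnInterval f b c) :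
    AbsolutelyContinuousOnInterval f a c := by
  refine absolutelyContinuousOnInterval_of_eq_integral (hab.trans hbc)
    (h1.intervalIntegrable_deriv.trans h2.intervalIntegrable_deriv) fun t ht => ?_
  rcases le_total t b with htb | htb
  · have h := h1.mono (c := a) (d := t)
      (by rw [uIcc_of_le ht.1, uIcc_of_le hab]; exact Icc_subset_Icc_right htb)
    rw [h.integral_deriv_eq_sub]; ring
  · have h := h2.mono (c := b) (d := t)
      (by rw [uIcc_of_le htb, uIcc_of_le hbc]; exact Icc_subset_Icc_right ht.2)
    rw [← intervalIntegral.integral_add_adjacent_intervals h1.intervalIntegrable_deriv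
      h.intervalIntegrable_deriv, h.integral_deriv_eq_sub, h1.integral_deriv_eq_sub]
    ring

lemma absolutelyContinuousOnInterval_comp_sub {f : ℝ → ℝ} {a b : ℝ} (c : ℝ) (hab : a ≤ b)
    (h : AbsolutelyContinuousOnInterval f a b) :
    AbsolutelyContinuousOnInterval (fun t => f (t - c)) (a + c) (b + c) := by
  refine absolutelyContinuousOnInterval_of_eq_integral (by linarith)
    (h.intervalIntegrable_deriv.comp_sub_right c) fun t ht => ?_
  have h' := h.mono (c := a) (d := t - c) (by
    rw [uIcc_of_le (by linarith [ht.1]), uIcc_of_le hab]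
    exact Icc_subset_Icc_right (by linarith [ht.2]))
  rw [intervalIntegral.integral_comp_sub_right (fun u => deriv f u) c, add_sub_cancel_right,
    h'.integral_deriv_eq_sub]
  ring

/-- The conditions on a trajectory and its velocity field at almost every time. -/
def IsAdmissibleAt {d : ℕ} {p : ℝ} (F : Pp d p → Rd d → Set (Rd d)) (μ : Pp d p)
    (v : Rd d → Rd d) : Prop :=
  Integrable v μ.toMeasure ∧ ∀ᵐ x ∂μ.toMeasure, v x ∈ F μ x

/-- The vector measures `ν t` are determined by `v` at almost every time, so they can be dropped;
only the velocity field has to be glued later. -/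
lemma mem_admissibleTrajectories_iff {d : ℕ} {p : ℝ} {F : Pp d p → Rd d → Set (Rd d)} {a b : ℝ}
    {μ : Pp d p} {θ : ℝ → Pp d p} :
    θ ∈ admissibleTrajectories F a b μ ↔ θ a = μ ∧
      (∀ t ∈ Icc a b, Tendsto (fun s => Wp (θ s) (θ t)) (𝓝[Icc a b] t) (𝓝 0)) ∧
      ∃ v : ℝ → Rd d → Rd d, Measurable (Function.uncurry v) ∧
        (∀ᵐ t, t ∈ Icc a b → IsAdmissibleAt F (θ t) (v t)) ∧
        ∀ φ : Rd d → ℝ, ContDiff ℝ 1 φ → HasCompactSupport φ →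
          AbsolutelyContinuousOnInterval (fun t => ∫ x, φ x ∂(θ t).toMeasure) a b ∧
          ∀ᵐ t, t ∈ Icc a b → HasDerivAt (fun s => ∫ x, φ x ∂(θ s).toMeasure)
            (∫ x, inner ℝ (gradient φ x) (v t x) ∂(θ t).toMeasure) t := by
  constructor
  · rintro ⟨h1, h2, ν, v, h⟩
    refine ⟨h1, h2, v, h.measurable, ?_, fun φ hφ hc => ?_⟩
    · rw [← ae_restrict_iff' measurableSet_Icc]
      filter_upwards [h.density, h.inclusion] with t ht1 ht2
      exact ⟨ht1.1, ht2⟩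
    · rw [← ae_restrict_iff' measurableSet_Icc]
      exact h.continuityEquation φ hφ hc
  · rintro ⟨h1, h2, v, hv, had, hce⟩
    rw [← ae_restrict_iff' measurableSet_Icc] at had
    refine ⟨h1, h2, fun t => (θ t).toMeasure.withDensityᵥ (v t), v, hv, ?_, ?_, fun φ hφ hc => ?_⟩
    · exact had.mono fun t ht => ⟨ht.1, rfl⟩
    · exact had.mono fun t ht => ht.2
    · rw [ae_restrict_iff' measurableSet_Icc]
      exact hce φ hφ hc

lemma ae_ne (t₀ : ℝ) : ∀ᵐ t : ℝ, t ≠ t₀ := by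
  simp [ae_iff]

lemma admissibleTrajectories_congr {d : ℕ} {p : ℝ} {F : Pp d p → Rd d → Set (Rd d)} {a b : ℝ}
    (hab : a ≤ b) {μ : Pp d p} {θ θ' : ℝ → Pp d p} (h : θ ∈ admissibleTrajectories F a b μ)
    (hθ : EqOn θ' θ (Icc a b)) : θ' ∈ admissibleTrajectories F a b μ := by
  rw [mem_admissibleTrajectories_iff] at h ⊢
  obtain ⟨h1, h2, v, hv, had, hce⟩ := h
  refine ⟨(hθ (left_mem_Icc.2 hab)).trans h1, fun t ht => ?_, v, hv, ?_, fun φ hφ hc => ?_⟩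
  · refine (h2 t ht).congr' ?_
    filter_upwards [self_mem_nhdsWithin] with s hs
    rw [hθ hs, hθ ht]
  · filter_upwards [had] with t ht htab
    rw [hθ htab]; exact ht htab
  · refine ⟨absolutelyContinuousOnInterval_congr hab (hce φ hφ hc).1 fun t ht => by
      simp only [hθ ht], ?_⟩
    -- `HasDerivAt` is two-sided and sees values outside `[a, b]` at the endpoints, which form a
    -- null set.
    filter_upwards [(hce φ hφ hc).2, ae_ne a, ae_ne b] with t ht hta htb htab
    rw [hθ htab]
    refine (ht htab).congr_of_eventuallyEq ?_
    filter_upwards [Icc_mem_nhds (lt_of_le_of_ne htab.1 hta.symm) (lt_of_le_of_ne htab.2 htb)]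
      with s hs
    rw [hθ hs]

lemma admissibleTrajectories_mono {d : ℕ} {p : ℝ} {F : Pp d p → Rd d → Set (Rd d)} {a b c : ℝ}
    {μ : Pp d p} {θ : ℝ → Pp d p} (h : θ ∈ admissibleTrajectories F a b μ) (hc : c ∈ Icc a b) :
    θ ∈ admissibleTrajectories F a c μ := by
  rw [mem_admissibleTrajectories_iff] at h ⊢
  obtain ⟨h1, h2, v, hv, had, hce⟩ := h
  have hsub : Icc a c ⊆ Icc a b := Icc_subset_Icc_right hc.2
  refine ⟨h1, fun t ht => (h2 t (hsub ht)).mono_left (nhdsWithin_mono t hsub), v, hv, ?_,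
    fun φ hφ hcs => ⟨(hce φ hφ hcs).1.mono ?_, ?_⟩⟩
  · exact had.mono fun t ht htc => ht (hsub htc)
  · rwa [uIcc_of_le hc.1, uIcc_of_le (hc.1.trans hc.2)]
  · exact (hce φ hφ hcs).2.mono fun t ht htc => ht (hsub htc)

/-- The interval `[a, a]` is null, so the constraints on the velocity are vacuous. -/
lemma const_mem_admissibleTrajectories {d : ℕ} {p : ℝ} (hp : 1 ≤ p)
    (F : Pp d p → Rd d → Set (Rd d)) (a : ℝ) (μ : Pp d p) :
    (fun _ => μ) ∈ admissibleTrajectories F a a μ := by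
  rw [mem_admissibleTrajectories_iff]
  have hae : ∀ P : ℝ → Prop, ∀ᵐ t, t ∈ Icc a a → P t := fun P => by
    filter_upwards [ae_ne a] with t ht hta
    exact absurd (by simpa using hta) ht
  refine ⟨rfl, fun t _ => by simpa [Wp_self hp] using tendsto_const_nhds, fun _ _ => 0, measurable_const, hae _,
    fun φ _ _ => ⟨?_, hae _⟩⟩
  exact (LipschitzWith.const _).lipschitzOnWith.absolutelyContinuousOnInterval

lemma comp_sub_mem_admissibleTrajectories {d : ℕ} {p : ℝ} {F : Pp d p → Rd d → Set (Rd d)}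
    {a b : ℝ} (hab : a ≤ b) {μ : Pp d p} {θ : ℝ → Pp d p}
    (h : θ ∈ admissibleTrajectories F a b μ) (c : ℝ) :
    (fun t => θ (t - c)) ∈ admissibleTrajectories F (a + c) (b + c) μ := by
  rw [mem_admissibleTrajectories_iff] at h ⊢
  obtain ⟨h1, h2, v, hv, had, hce⟩ := h
  have hmem : ∀ {t}, t ∈ Icc (a + c) (b + c) → t - c ∈ Icc a b := fun ht =>
    ⟨by linarith [ht.1], by linarith [ht.2]⟩
  have hq := (measurePreserving_sub_right (volume : Measure ℝ) c).quasiMeasurePreserving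
  refine ⟨by simpa using h1, fun t ht => ?_, fun t => v (t - c), ?_, ?_, fun φ hφ hcs => ⟨?_, ?_⟩⟩
  · have hlim : Tendsto (fun s : ℝ => s - c) (𝓝[Icc (a + c) (b + c)] t) (𝓝[Icc a b] (t - c)) := by
      refine tendsto_nhdsWithin_iff.2 ⟨?_, ?_⟩
      · exact ((continuous_sub_right c).tendsto t).mono_left nhdsWithin_le_nhds
      · filter_upwards [self_mem_nhdsWithin] with s hs using hmem hs
    exact Tendsto.comp (g := fun s => Wp (θ s) (θ (t - c))) (h2 (t - c) (hmem ht)) hlim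
  · exact hv.comp ((measurable_fst.sub_const c).prodMk measurable_snd)
  · filter_upwards [hq.ae had] with t ht htc using ht (hmem htc)
  · exact absolutelyContinuousOnInterval_comp_sub (f := fun t => ∫ x, φ x ∂(θ t).toMeasure) c hab
      (hce φ hφ hcs).1
  · filter_upwards [hq.ae (hce φ hφ hcs).2] with t ht htc
    exact HasDerivAt.comp_sub_const (f := fun t => ∫ x, φ x ∂(θ t).toMeasure) t c (ht (hmem htc))

lemma admissibleTrajectories_trans {d : ℕ} {p : ℝ} {F : Pp d p → Rd d → Set (Rd d)} {a b c : ℝ}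
    (hab : a ≤ b) (hbc : b ≤ c) {μ : Pp d p} {θ : ℝ → Pp d p}
    (h : θ ∈ admissibleTrajectories F a b μ) (h' : θ ∈ admissibleTrajectories F b c (θ b)) :
    θ ∈ admissibleTrajectories F a c μ := by
  rw [mem_admissibleTrajectories_iff] at h h' ⊢
  obtain ⟨h1, h2, v, hv, had, hce⟩ := h
  obtain ⟨-, h2', v', hv', had', hce'⟩ := h'
  have hS : MeasurableSet {z : ℝ × Rd d | z.1 ≤ b} := measurableSet_le measurable_fst measurable_const
  refine ⟨h1, fun t ht => ?_, fun t => if t ≤ b then v t else v' t, ?_, ?_, fun φ hφ hcs => ⟨?_, ?_⟩⟩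
  · rw [← Icc_union_Icc_eq_Icc hab hbc, nhdsWithin_union]
    refine Tendsto.sup ?_ ?_
    · rcases le_or_gt t b with htb | htb
      · exact h2 t ⟨ht.1, htb⟩
      · have : 𝓝[Icc a b] t = ⊥ := by
          rw [← notMem_closure_iff_nhdsWithin_eq_bot, closure_Icc]
          exact fun h => htb.not_ge h.2
        rw [this]; exact tendsto_bot
    · rcases le_or_gt b t with htb | htb
      · exact h2' t ⟨htb, ht.2⟩
      · have : 𝓝[Icc b c] t = ⊥ := by
          rw [← notMem_closure_iff_nhdsWithin_eq_bot, closure_Icc]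
          exact fun h => htb.not_ge h.1
        rw [this]; exact tendsto_bot
  · have : Function.uncurry (fun t => if t ≤ b then v t else v' t) =
        fun z : ℝ × Rd d => if z.1 ≤ b then Function.uncurry v z else Function.uncurry v' z := by
      ext1 z
      simp only [Function.uncurry]
      split_ifs <;> rfl
    rw [this]
    exact Measurable.ite hS hv hv'
  · filter_upwards [had, had'] with t ht ht' htc
    split_ifs with htb
    · exact ht ⟨htc.1, htb⟩
    · exact ht' ⟨(not_le.1 htb).le, htc.2⟩
  · exact absolutelyContinuousOnInterval_trans hab hbc (hce φ hφ hcs).1 (hce' φ hφ hcs).1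
  · filter_upwards [(hce φ hφ hcs).2, (hce' φ hφ hcs).2] with t ht ht' htc
    split_ifs with htb
    · exact ht ⟨htc.1, htb⟩
    · exact ht' ⟨(not_le.1 htb).le, htc.2⟩

/-- The concatenation at time `a` of two trajectories. -/
def concat {α : Type*} (a : ℝ) (θ₁ θ₂ : ℝ → α) (t : ℝ) : α := if t ≤ a then θ₁ t else θ₂ (t - a)

lemma concat_mem_admissibleTrajectories {d : ℕ} {p : ℝ} {F : Pp d p → Rd d → Set (Rd d)} {a b : ℝ}
    (ha : 0 ≤ a) (hb : 0 ≤ b) {μ : Pp d p} {θ₁ θ₂ : ℝ → Pp d p}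
    (h₁ : θ₁ ∈ admissibleTrajectories F 0 a μ)
    (h₂ : θ₂ ∈ admissibleTrajectories F 0 b (θ₁ a)) :
    concat a θ₁ θ₂ ∈ admissibleTrajectories F 0 (a + b) μ := by
  have ea : concat a θ₁ θ₂ a = θ₁ a := by simp [concat]
  refine admissibleTrajectories_trans ha (by linarith)
    (admissibleTrajectories_congr ha h₁ fun t ht => by simp [concat, ht.2]) ?_
  have h := comp_sub_mem_admissibleTrajectories hb h₂ a
  rw [zero_add, add_comm b a] at h
  rw [ea]
  refine admissibleTrajectories_congr (by linarith) h fun t ht => ?_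
  -- At the junction `concat` reads `θ₁ a`, which the initial condition identifies with `θ₂ 0`.
  rcases ht.1.eq_or_lt with rfl | hlt
  · rw [ea, sub_self]; exact h₂.1.symm
  · simp [concat, hlt]

/-! ### Uniform integrability, compactness and identification of limits. -/

/-- Beyond radius `R` the weight is at least `lam`, so the damping factor is at least `1 / 2`; this
is the source of the factor `2`. -/
lemma setLIntegral_enorm_rpow_le_moment {d : ℕ} {p lam : ℝ} (hp : 0 ≤ p) (hl : 0 ≤ lam)
    (μ : Pp d p) {R : ℝ≥0} (hR : lam ≤ (R : ℝ) ^ 2) :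
    ∫⁻ x in {x | (R : ℝ) < ‖x‖}, ‖x‖ₑ ^ p ∂μ.toMeasure ≤ 2 * ENNReal.ofReal (moment lam μ) := by
  have hint := integrable_momentFn hp hl μ
  have hS : MeasurableSet {x : Rd d | (R : ℝ) < ‖x‖} := measurableSet_lt (by fun_prop) (by fun_prop)
  have hm : Measurable fun x : Rd d => ENNReal.ofReal (momentFn p lam x) :=
    (continuous_momentFn hl).measurable.ennreal_ofReal
  calc ∫⁻ x in {x | (R : ℝ) < ‖x‖}, ‖x‖ₑ ^ p ∂μ.toMeasure
      ≤ ∫⁻ x in {x | (R : ℝ) < ‖x‖}, 2 * ENNReal.ofReal (momentFn p lam x) ∂μ.toMeasure := by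
        refine setLIntegral_mono (hm.const_mul 2) fun x hx => ?_
        have e : 2 * ENNReal.ofReal (momentFn p lam x) = ENNReal.ofReal (2 * momentFn p lam x) := by
          rw [ENNReal.ofReal_mul zero_le_two, ENNReal.ofReal_ofNat]
        rw [← ofReal_norm_rpow hp, e]
        refine ENNReal.ofReal_le_ofReal ((norm_rpow_le_weight hp x).trans ?_)
        have hw := weight_pos x
        have hx' : (R : ℝ) < ‖x‖ := hx
        have h1 : lam ≤ weight x := by
          have : (R : ℝ) ^ 2 ≤ ‖x‖ ^ 2 := by gcongr
          unfold weight; linarith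
        have h2 : 1 ≤ 2 * (weight x / (lam + weight x)) := by
          rw [mul_div_assoc', le_div_iff₀ (by positivity)]; linarith
        calc weight x ^ (p / 2) ≤ weight x ^ (p / 2) * (2 * (weight x / (lam + weight x))) :=
              le_mul_of_one_le_right (by positivity) h2
          _ = _ := by unfold momentFn; ring
    _ ≤ ∫⁻ x, 2 * ENNReal.ofReal (momentFn p lam x) ∂μ.toMeasure :=
        setLIntegral_le_lintegral _ _
    _ = _ := by
        rw [lintegral_const_mul _ hm, moment, ofReal_integral_eq_lintegral_ofReal hint
          (Eventually.of_forall fun x => momentFn_nonneg hl x)]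

/-- Dominated convergence: the damping kills each point as `lam → ∞`. With a growth rate uniform in
`lam`, smallness at the initial measure spreads to the whole trajectory. -/
lemma tendsto_moment_atTop {d : ℕ} {p : ℝ} (hp : 0 ≤ p) (μ : Pp d p) :
    Tendsto (fun n : ℕ => moment (n : ℝ) μ) atTop (𝓝 0) := by
  have h : Tendsto (fun n : ℕ => ∫ x, momentFn p (n : ℝ) x ∂μ.toMeasure) atTop
      (𝓝 (∫ _, (0 : ℝ) ∂μ.toMeasure)) := by
    refine tendsto_integral_of_dominated_convergence (fun x => weight x ^ (p / 2))
      (fun n => (continuous_momentFn n.cast_nonneg).aestronglyMeasurable)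
      (integrable_weight_rpow hp μ) (fun n => Eventually.of_forall fun x => ?_)
      (Eventually.of_forall fun x => ?_)
    · rw [Real.norm_of_nonneg (momentFn_nonneg n.cast_nonneg x)]
      exact momentFn_le n.cast_nonneg x
    · have h1 : Tendsto (fun n : ℕ => weight x / ((n : ℝ) + weight x)) atTop (𝓝 0) :=
        Tendsto.const_div_atTop (tendsto_natCast_atTop_atTop.atTop_add tendsto_const_nhds) _
      simpa [momentFn] using h1.const_mul (weight x ^ (p / 2))
  simpa [moment] using h

lemma lintegral_momentFn_le_of_tendsto {d : ℕ} {p lam E : ℝ} (hp : 0 ≤ p) (hl : 0 ≤ lam)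
    {μ : ℕ → Pp d p} {ν : ProbabilityMeasure (Rd d)}
    (hlim : Tendsto (fun n => (μ n).1) atTop (𝓝 ν)) (hE : ∀ n, moment lam (μ n) ≤ E) :
    ∫⁻ x, ENNReal.ofReal (momentFn p lam x) ∂(ν : Measure (Rd d)) ≤ ENNReal.ofReal E := by
  refine (lintegral_le_liminf_lintegral_of_forall_isOpen_measure_le_liminf_measure
    (μs := fun n => (μ n).toMeasure) (continuous_momentFn hl) (fun x => momentFn_nonneg hl x)
    fun G hG => ProbabilityMeasure.le_liminf_measure_open_of_tendsto hlim hG).trans ?_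
  refine (liminf_le_liminf (v := fun _ => ENNReal.ofReal E)
    (Eventually.of_forall fun n => ?_)).trans (liminf_const _).le
  change ∫⁻ x, ENNReal.ofReal (momentFn p lam x) ∂(μ n).toMeasure ≤ ENNReal.ofReal E
  rw [← ofReal_integral_eq_lintegral_ofReal (integrable_momentFn hp hl _)
    (Eventually.of_forall fun x => momentFn_nonneg hl x)]
  exact ENNReal.ofReal_le_ofReal (hE n)

lemma integral_eq_integral_rnDeriv_mul {E : Type*} [MeasurableSpace E] (μ ν : Measure E)
    [IsFiniteMeasure μ] [IsFiniteMeasure ν] (h : μ ≪ ν) (φ : E → ℝ) :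
    ∫ x, φ x • (μ.rnDeriv ν x).toReal ∂ν = ∫ x, φ x ∂μ := by
  rw [← integral_rnDeriv_smul h]
  simp only [smul_eq_mul, mul_comm]

open scoped ContDiff in
/-- Compactly supported `C¹` functions separate finite measures. -/
lemma measure_eq_of_forall_integral_eq {E : Type*} [NormedAddCommGroup E] [NormedSpace ℝ E]
    [FiniteDimensional ℝ E] [MeasurableSpace E] [BorelSpace E] {μ ν : Measure E}
    [IsFiniteMeasure μ] [IsFiniteMeasure ν] (h : ∀ φ : E → ℝ, ContDiff ℝ 1 φ → HasCompactSupport φ →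
      ∫ x, φ x ∂μ = ∫ x, φ x ∂ν) : μ = ν := by
  -- Densities with respect to `μ + ν` reduce the claim to the fundamental lemma of the calculus of
  -- variations for functions.
  have hμ : μ ≪ μ + ν := Measure.absolutelyContinuous_of_le (Measure.le_add_right le_rfl)
  have hν : ν ≪ μ + ν := Measure.absolutelyContinuous_of_le (Measure.le_add_left le_rfl)
  have hint : ∀ φ : E → ℝ, ContDiff ℝ ∞ φ → HasCompactSupport φ →
      ∫ x, φ x • (μ.rnDeriv (μ + ν) x).toReal ∂(μ + ν) =
        ∫ x, φ x • (ν.rnDeriv (μ + ν) x).toReal ∂(μ + ν) := by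
    intro φ hφ hc
    rw [integral_eq_integral_rnDeriv_mul _ _ hμ, integral_eq_integral_rnDeriv_mul _ _ hν]
    exact h φ (hφ.of_le (mod_cast le_top)) hc
  have l1 : LocallyIntegrable (fun x => (μ.rnDeriv (μ + ν) x).toReal) (μ + ν) :=
    Measure.integrable_toReal_rnDeriv.locallyIntegrable
  have l2 : LocallyIntegrable (fun x => (ν.rnDeriv (μ + ν) x).toReal) (μ + ν) :=
    Measure.integrable_toReal_rnDeriv.locallyIntegrable
  have hae := ae_eq_of_integral_contDiff_smul_eq l1 l2 hint
  have e : (μ + ν).withDensity (μ.rnDeriv (μ + ν)) = (μ + ν).withDensity (ν.rnDeriv (μ + ν)) := by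
    refine withDensity_congr_ae ?_
    filter_upwards [hae, μ.rnDeriv_lt_top (μ + ν), ν.rnDeriv_lt_top (μ + ν)] with x hx h1 h2
    exact (ENNReal.toReal_eq_toReal_iff' h1.ne h2.ne).1 hx
  rwa [Measure.withDensity_rnDeriv_eq μ (μ + ν) hμ,
    Measure.withDensity_rnDeriv_eq ν (μ + ν) hν] at e

/-- The compact support of the derivative absorbs the linear growth of the velocity. -/
lemma exists_norm_fderiv_mul_le {d : ℕ} {φ : Rd d → ℝ} (hφ : ContDiff ℝ 1 φ)
    (hc : HasCompactSupport φ) (A L : ℝ) :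
    ∃ B, 0 ≤ B ∧ ∀ x v : Rd d, ‖v‖ ≤ A + L * ‖x‖ → |inner ℝ (gradient φ x) v| ≤ B := by
  have hcont : Continuous (fderiv ℝ φ) := hφ.continuous_fderiv (by simp)
  have hsupp : HasCompactSupport fun x => ‖fderiv ℝ φ x‖ * (A + L * ‖x‖) :=
    (hc.fderiv ℝ).norm.mul_right
  obtain ⟨B, hB⟩ := hsupp.exists_bound_of_continuous (by fun_prop)
  refine ⟨B, (norm_nonneg _).trans (hB 0), fun x v hv => ?_⟩
  rw [inner_gradient_eq_fderiv, ← Real.norm_eq_abs]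
  calc ‖fderiv ℝ φ x v‖ ≤ ‖fderiv ℝ φ x‖ * ‖v‖ := ContinuousLinearMap.le_opNorm _ _
    _ ≤ ‖fderiv ℝ φ x‖ * (A + L * ‖x‖) := by gcongr
    _ ≤ B := (le_abs_self _).trans (hB x)

/-- Uniform Lipschitz bound for the integrals of a test function along trajectories whose
`p`-moment is controlled. -/
lemma exists_lipschitz_integral {d : ℕ} {p L : ℝ} (hp : 1 ≤ p) {F : Pp d p → Rd d → Set (Rd d)}
    (hF : IsLipschitzDynamics F L) (R : ℝ) {φ : Rd d → ℝ} (hφ : ContDiff ℝ 1 φ)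
    (hc : HasCompactSupport φ) :
    ∃ B : ℝ≥0, ∀ (b : ℝ) (μ : Pp d p) (θ : ℝ → Pp d p),
      θ ∈ admissibleTrajectories F 0 b μ → (∀ t ∈ Icc 0 b, moment 0 (θ t) ≤ R) →
      ∀ s ∈ Icc 0 b, ∀ t ∈ Icc 0 b, s ≤ t →
        |∫ x, φ x ∂(θ t).toMeasure - ∫ x, φ x ∂(θ s).toMeasure| ≤ B * (t - s) := by
  have hp0 : 0 < p := by linarith
  obtain ⟨K, hK, hv⟩ := exists_norm_le_of_isLipschitzDynamics hp0 hF
  have hL := hF.pos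
  set m := (max R 0) ^ (1 / p) with hm
  obtain ⟨B, hB0, hB⟩ := exists_norm_fderiv_mul_le hφ hc (K + L * m) L
  refine ⟨⟨B, hB0⟩, fun b μ θ hθ hR s hs t ht hst => ?_⟩
  obtain ⟨-, -, v, -, had, hce⟩ := mem_admissibleTrajectories_iff.1 hθ
  have hsub : Icc s t ⊆ Icc 0 b := Icc_subset_Icc hs.1 ht.2
  have hb : 0 ≤ b := hs.1.trans hs.2
  have h := abs_sub_le_integral_of_absolutelyContinuous (g := fun _ => B) hst
    ((hce φ hφ hc).1.mono (by rwa [uIcc_of_le hst, uIcc_of_le hb]))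
    ((ae_restrict_iff' measurableSet_Icc).2
      ((hce φ hφ hc).2.mono fun u hu hust => hu (hsub hust))) (by simp) (by
      rw [ae_restrict_iff' measurableSet_Icc]
      filter_upwards [had] with u hu hust
      have hWm : Wp (Pp.dirac d hp0) (θ u) ≤ m := by
        rw [hm, one_div, Real.le_rpow_inv_iff_of_pos (Wp_nonneg _ _) (le_max_right _ _) hp0]
        exact (Wp_dirac_rpow_le_moment hp0 _).trans ((hR u (hsub hust)).trans (le_max_left _ _))
      rw [← Real.norm_eq_abs]
      refine (norm_integral_le_of_norm_le (integrable_const B) ?_).trans (by simp)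
      filter_upwards [(hu (hsub hust)).2] with x hx
      refine hB x _ ((hv _ x _ hx).trans ?_)
      gcongr)
  rw [intervalIntegral.integral_const, smul_eq_mul, mul_comm] at h
  exact h

/-- Markov's inequality gives tightness, and Prokhorov's theorem turns it into compactness. -/
lemma isCompact_closure_of_moment_le {d : ℕ} {p : ℝ} (hp : 1 ≤ p) {S : Set (Pp d p)} {R : ℝ}
    (hR : ∀ μ ∈ S, moment 0 μ ≤ R) :
    IsCompact (closure ((fun μ : Pp d p => μ.1) '' S)) := by
  refine isCompact_closure_of_isTightMeasureSet ?_
  rw [isTightMeasureSet_iff_exists_isCompact_measure_compl_le]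
  intro ε hε
  have hlim : Tendsto (fun r : ℝ => ENNReal.ofReal (R / r)) atTop (𝓝 0) := by
    have := ENNReal.tendsto_ofReal (tendsto_const_nhds (x := R).div_atTop tendsto_id)
    simpa using this
  obtain ⟨r, hr, hr0⟩ := ((hlim.eventually (ge_mem_nhds hε)).and (eventually_gt_atTop 0)).exists
  refine ⟨Metric.closedBall 0 r, isCompact_closedBall _ _, ?_⟩
  rintro _ ⟨_, ⟨μ, hμ, rfl⟩, rfl⟩
  refine le_trans ?_ hr
  change μ.toMeasure _ ≤ _
  have hsub : (Metric.closedBall (0 : Rd d) r)ᶜ ⊆ {x | r ≤ momentFn p 0 x} := by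
    intro x hx
    have hx' : r < ‖x‖ := by simpa using hx
    rw [mem_ofPred_eq, momentFn_zero]
    have h1 : ‖x‖ ≤ weight x ^ (1 / 2 : ℝ) := by
      simpa using norm_rpow_le_weight (p := 1) zero_le_one x
    have h2 : weight x ^ (1 / 2 : ℝ) ≤ weight x ^ (p / 2) :=
      Real.rpow_le_rpow_of_exponent_le (one_le_weight x) (by linarith)
    linarith
  have hmarkov := mul_meas_ge_le_integral_of_nonneg (μ := μ.toMeasure)
    (Eventually.of_forall fun x => momentFn_nonneg le_rfl x)
    (integrable_momentFn (by linarith) le_rfl μ) r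
  have hreal : μ.toMeasure.real {x | r ≤ momentFn p 0 x} ≤ R / r := by
    rw [le_div_iff₀ hr0, mul_comm]
    exact hmarkov.trans (hR μ hμ)
  refine (measure_mono hsub).trans ?_
  rw [← ofReal_measureReal]
  exact ENNReal.ofReal_le_ofReal hreal

/-- Narrow convergence from precompactness and convergence against compactly supported `C¹`
functions. -/
lemma exists_tendsto_of_isCompact {d : ℕ} {ι : Type*} {l : Filter ι} [l.NeBot]
    {μ : ι → ProbabilityMeasure (Rd d)} {K : Set (ProbabilityMeasure (Rd d))} (hK : IsCompact K)
    (hμ : ∀ᶠ i in l, μ i ∈ K)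
    (hφ : ∀ φ : Rd d → ℝ, ContDiff ℝ 1 φ → HasCompactSupport φ →
      ∃ c, Tendsto (fun i => ∫ x, φ x ∂(μ i : Measure (Rd d))) l (𝓝 c)) :
    ∃ ν, Tendsto μ l (𝓝 ν) := by
  have key : ∀ ν, MapClusterPt ν l μ → ∀ φ : Rd d → ℝ, ContDiff ℝ 1 φ → HasCompactSupport φ →
      ∀ c, Tendsto (fun i => ∫ x, φ x ∂(μ i : Measure (Rd d))) l (𝓝 c) →
        ∫ x, φ x ∂(ν : Measure (Rd d)) = c := by
    intro ν hν φ hφ1 hφc c hc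
    obtain ⟨B, hB⟩ := hφc.exists_bound_of_continuous hφ1.continuous
    set f : Rd d →ᵇ ℝ := BoundedContinuousFunction.ofNormedAddCommGroup φ hφ1.continuous B hB
    have hcont : Tendsto (fun ρ : ProbabilityMeasure (Rd d) => ∫ x, φ x ∂(ρ : Measure (Rd d)))
        (𝓝 ν) (𝓝 (∫ x, φ x ∂(ν : Measure (Rd d)))) :=
      (ProbabilityMeasure.tendsto_iff_forall_integral_tendsto.1 tendsto_id) f
    have h1 := hν.tendsto_comp hcont
    have h2 : ClusterPt (∫ x, φ x ∂(ν : Measure (Rd d))) (𝓝 c) := h1.clusterPt.mono hc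
    exact eq_of_nhds_neBot h2
  obtain ⟨ν, -, hν⟩ := hK.exists_mapClusterPt_of_frequently hμ.frequently
  -- In a compact set a unique cluster point is the limit; test functions separate any two
  -- candidates.
  refine ⟨ν, hK.tendsto_nhds_of_unique_mapClusterPt hμ fun ρ _ hρ => ?_⟩
  have := ρ.2
  have := ν.2
  refine Subtype.ext (measure_eq_of_forall_integral_eq fun φ hφ1 hφc => ?_)
  obtain ⟨c, hc⟩ := hφ φ hφ1 hφc
  exact (key ρ hρ φ hφ1 hφc c hc).trans (key ν hν φ hφ1 hφc c hc).symm

/-! ### Extension of a trajectory to its final time. -/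

lemma nhdsWithin_Icc_le_pure_sup {a T : ℝ} : 𝓝[Icc a T] T ≤ pure T ⊔ 𝓝[<] T := by
  rw [← nhdsWithin_singleton, ← nhdsWithin_union]
  refine nhdsWithin_mono T fun t ht => ?_
  rcases ht.2.eq_or_lt with h | h
  · exact Or.inl h
  · exact Or.inr h

/-- A trajectory on a half-open bounded time interval extends to the closed interval. -/
lemma exists_update_mem_admissibleTrajectories {d : ℕ} {p L : ℝ} (hp : 1 ≤ p)
    {F : Pp d p → Rd d → Set (Rd d)} (hF : IsLipschitzDynamics F L) {τ : ℕ → ℝ} {T : ℝ}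
    (hτ : StrictMono τ) (hτ0 : ∀ n, 0 ≤ τ n) (hT : Tendsto τ atTop (𝓝 T)) {μ : Pp d p}
    {θ : ℝ → Pp d p} (hθ : ∀ n, θ ∈ admissibleTrajectories F 0 (τ n) μ) :
    ∃ μT : Pp d p, Function.update θ T μT ∈ admissibleTrajectories F 0 T μ ∧
      Tendsto (fun n => (θ (τ n)).1) atTop (𝓝 μT.1) := by
  have hp0 : 0 ≤ p := by linarith
  have hτT : ∀ n, τ n < T := fun n =>
    (hτ n.lt_succ_self).trans_le (hτ.monotone.ge_of_tendsto hT (n + 1))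
  have hT0 : 0 < T := (hτ0 0).trans_lt (hτT 0)
  have hex : ∀ t, t < T → ∃ n, t < τ n := fun t ht => (hT.eventually (lt_mem_nhds ht)).exists
  have hadm : ∀ t ∈ Ico 0 T, θ ∈ admissibleTrajectories F 0 t μ := fun t ht => by
    obtain ⟨n, hn⟩ := hex t ht.2
    exact admissibleTrajectories_mono (hθ n) ⟨ht.1, hn.le⟩
  have hτlt : Tendsto τ atTop (𝓝[<] T) :=
    tendsto_nhdsWithin_iff.2 ⟨hT, Eventually.of_forall hτT⟩
  have hIco : ∀ᶠ t in 𝓝[<] T, t ∈ Ico 0 T := by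
    filter_upwards [self_mem_nhdsWithin, nhdsWithin_le_nhds (lt_mem_nhds hT0)] with t h1 h2
    exact ⟨h2.le, h1⟩
  obtain ⟨C, hC, hCm⟩ := exists_moment_zero_le hp hF
  set R := moment 0 μ * Real.exp (C * T) with hRdef
  have hR : ∀ t ∈ Ico 0 T, moment 0 (θ t) ≤ R := fun t ht => by
    refine (hCm 0 t μ θ ht.1 (hadm t ht)).trans ?_
    have := moment_nonneg (le_refl 0) μ
    rw [hRdef]
    gcongr
    linarith [ht.2]
  obtain ⟨C', hC', hCm'⟩ := exists_moment_le_mul_exp hp hF R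
  set E : ℝ → ℝ := fun lam => moment lam μ * Real.exp (C' * T) with hE
  have hEm : ∀ lam, 0 ≤ lam → ∀ t ∈ Ico 0 T, moment lam (θ t) ≤ E lam := fun lam hl t ht => by
    refine (hCm' lam hl 0 t μ θ ht.1 (hadm t ht)
      fun s hs => hR s ⟨hs.1, hs.2.trans_lt ht.2⟩).trans ?_
    have := moment_nonneg hl μ
    simp only [hE]
    gcongr
    linarith [ht.2]
  -- A Lipschitz extension `g` to the whole line gives both the limit of `∫ φ` at `T` and absolute
  -- continuity on the closed interval.
  have hLip : ∀ φ : Rd d → ℝ, ContDiff ℝ 1 φ → HasCompactSupport φ → ∃ B : ℝ≥0, ∃ g : ℝ → ℝ,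
      LipschitzWith B g ∧ EqOn (fun t => ∫ x, φ x ∂(θ t).toMeasure) g (Ico 0 T) := by
    intro φ hφ hc
    obtain ⟨B, hB⟩ := exists_lipschitz_integral hp hF R hφ hc
    have key : ∀ s ∈ Ico 0 T, ∀ t ∈ Ico 0 T, s ≤ t →
        |∫ x, φ x ∂(θ t).toMeasure - ∫ x, φ x ∂(θ s).toMeasure| ≤ B * (t - s) :=
      fun s hs t ht hst => hB t μ θ (hadm t ht) (fun u hu => hR u ⟨hu.1, hu.2.trans_lt ht.2⟩)
        s ⟨hs.1, hst⟩ t ⟨ht.1, le_rfl⟩ hst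
    refine ⟨B, LipschitzOnWith.extend_real (LipschitzOnWith.of_dist_le_mul fun s hs t ht => ?_)⟩
    rcases le_total s t with h | h
    · rw [dist_comm, dist_comm s t, Real.dist_eq, Real.dist_eq, abs_of_nonneg (sub_nonneg.2 h)]
      exact key s hs t ht h
    · rw [Real.dist_eq, Real.dist_eq, abs_of_nonneg (sub_nonneg.2 h)]
      exact key t ht s hs h
  have hcomp := isCompact_closure_of_moment_le hp (S := θ '' Ico 0 T) (R := R) (by
    rintro _ ⟨t, ht, rfl⟩; exact hR t ht)
  obtain ⟨ν, hν⟩ := exists_tendsto_of_isCompact (l := 𝓝[<] T) (μ := fun t => (θ t).1) hcomp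
    (hIco.mono fun t ht => subset_closure ⟨_, ⟨t, ht, rfl⟩, rfl⟩) fun φ hφ hc => by
      obtain ⟨B, g, hg, hgθ⟩ := hLip φ hφ hc
      refine ⟨g T, ((hg.continuous.tendsto T).mono_left nhdsWithin_le_nhds).congr' ?_⟩
      exact hIco.mono fun t ht => (hgθ ht).symm
  have hντ : Tendsto (fun n => (θ (τ n)).1) atTop (𝓝 ν) := hν.comp hτlt
  have hνm : ∀ lam, 0 ≤ lam →
      ∫⁻ x, ENNReal.ofReal (momentFn p lam x) ∂(ν : Measure (Rd d)) ≤ ENNReal.ofReal (E lam) :=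
    fun lam hl => lintegral_momentFn_le_of_tendsto hp0 hl hντ
      fun n => hEm lam hl (τ n) ⟨hτ0 n, hτT n⟩
  have hνfin : ∫⁻ x, ‖x‖ₑ ^ p ∂(ν : Measure (Rd d)) < ∞ := by
    refine lt_of_le_of_lt (lintegral_mono fun x => ?_) ((hνm 0 le_rfl).trans_lt
      ENNReal.ofReal_lt_top)
    rw [← ofReal_norm_rpow hp0, momentFn_zero]
    exact ENNReal.ofReal_le_ofReal (norm_rpow_le_weight hp0 x)
  set μT : Pp d p := ⟨ν, hνfin⟩
  have hE0 : ∀ lam, 0 ≤ lam → 0 ≤ E lam := fun lam hl =>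
    mul_nonneg (moment_nonneg hl μ) (Real.exp_pos _).le
  have hTm : ∀ lam, 0 ≤ lam → moment lam μT ≤ E lam := fun lam hl => by
    have h := hνm lam hl
    rw [← ENNReal.ofReal_le_ofReal_iff (hE0 lam hl), moment,
      ofReal_integral_eq_lintegral_ofReal (integrable_momentFn hp0 hl μT)
        (Eventually.of_forall fun x => momentFn_nonneg hl x)]
    exact h
  have hElim : Tendsto (fun n : ℕ => 2 * ENNReal.ofReal (E n)) atTop (𝓝 0) := by
    have h1 : Tendsto (fun n : ℕ => E n) atTop (𝓝 0) := by
      simpa [hE] using (tendsto_moment_atTop hp0 μ).mul_const (Real.exp (C' * T))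
    have h2 := ENNReal.Tendsto.const_mul (a := 2) (ENNReal.tendsto_ofReal h1) (Or.inr (by simp))
    simpa using h2
  have hWp : Tendsto (fun t => Wp (θ t) μT) (𝓝[<] T) (𝓝 0) := by
    refine tendsto_Wp_of_tendsto hp hν fun ε hε => ?_
    obtain ⟨n, hn⟩ := (hElim.eventually (ge_mem_nhds hε)).exists
    have hn0 : (0 : ℝ) ≤ n := n.cast_nonneg
    have hsq : (n : ℝ) ≤ ((NNReal.sqrt n : ℝ≥0) : ℝ) ^ 2 := by
      rw [← NNReal.coe_pow, NNReal.sq_sqrt, NNReal.coe_natCast]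
    refine ⟨NNReal.sqrt n, hIco.mono fun t ht => ?_, ?_⟩
    · refine (setLIntegral_enorm_rpow_le_moment hp0 hn0 _ hsq).trans (le_trans ?_ hn)
      gcongr
      exact hEm n hn0 t ht
    · refine (setLIntegral_enorm_rpow_le_moment hp0 hn0 _ hsq).trans (le_trans ?_ hn)
      gcongr
      exact hTm n hn0
  refine ⟨μT, ?_, hντ⟩
  set θ' := Function.update θ T μT
  have hθ'T : θ' T = μT := Function.update_self _ _ _
  have hθ'lt : ∀ {t}, t < T → θ' t = θ t := fun ht => Function.update_of_ne ht.ne _ _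
  have hθ'n : ∀ n, θ' ∈ admissibleTrajectories F 0 (τ n) μ := fun n =>
    admissibleTrajectories_congr (hτ0 n) (hθ n) fun t ht => hθ'lt (ht.2.trans_lt (hτT n))
  have hn := fun n => mem_admissibleTrajectories_iff.1 (hθ'n n)
  choose h0 hcont v hv had hce using hn
  rw [mem_admissibleTrajectories_iff]
  classical
  -- The velocity at time `t` is taken from the first index with `t < τ n`; the alternative `T ≤ t`
  -- only makes the search total. Countably many exceptional null sets are harmless.
  have hP : ∀ t : ℝ, ∃ n, t < τ n ∨ T ≤ t := fun t => by
    rcases lt_or_ge t T with h | h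
    · exact (hex t h).imp fun n => Or.inl
    · exact ⟨0, Or.inr h⟩
  have hfind : ∀ t, t < T → t < τ (Nat.find (hP t)) := fun t ht =>
    (Nat.find_spec (hP t)).resolve_right ht.not_ge
  refine ⟨h0 0, fun t ht => ?_, fun t => v (Nat.find (hP t)) t, ?_, ?_, fun φ hφ hc => ⟨?_, ?_⟩⟩
  · rcases ht.2.eq_or_lt with rfl | htT
    · refine Tendsto.mono_left (Tendsto.sup ?_ ?_) nhdsWithin_Icc_le_pure_sup
      · rw [tendsto_pure_left]
        intro s hs
        rw [Wp_self hp]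
        exact mem_of_mem_nhds hs
      · rw [hθ'T]
        refine hWp.congr' ?_
        filter_upwards [self_mem_nhdsWithin] with s hs
        rw [hθ'lt hs]
    · obtain ⟨n, hn⟩ := hex t htT
      refine (hcont n t ⟨ht.1, hn.le⟩).mono_left ?_
      rw [nhdsWithin_le_iff]
      filter_upwards [self_mem_nhdsWithin, nhdsWithin_le_nhds (gt_mem_nhds hn)] with s hs1 hs2
      exact ⟨hs1.1, hs2.le⟩
  · exact Measurable.find (f := fun n => Function.uncurry (v n))
      (p := fun n (z : ℝ × Rd d) => z.1 < τ n ∨ T ≤ z.1) hv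
      (fun n => (measurableSet_lt measurable_fst measurable_const).union
        (measurableSet_le measurable_const measurable_fst)) (fun z => hP z.1)
  · filter_upwards [ae_all_iff.2 had, ae_ne T] with t ht htT htI
    exact ht _ ⟨htI.1, (hfind t (lt_of_le_of_ne htI.2 htT)).le⟩
  · obtain ⟨B, g, hg, hgθ⟩ := hLip φ hφ hc
    refine absolutelyContinuousOnInterval_congr hT0.le
      (hg.lipschitzOnWith.absolutelyContinuousOnInterval) fun t ht => ?_
    rcases ht.2.eq_or_lt with rfl | htT
    · obtain ⟨D, hD⟩ := hc.exists_bound_of_continuous hφ.continuous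
      have h1 : Tendsto (fun t => ∫ x, φ x ∂(θ t).toMeasure) (𝓝[<] t)
          (𝓝 (∫ x, φ x ∂(ν : Measure (Rd d)))) :=
        ProbabilityMeasure.tendsto_iff_forall_integral_tendsto.1 hν
          (BoundedContinuousFunction.ofNormedAddCommGroup φ hφ.continuous D hD)
      have h2 : Tendsto (fun t => ∫ x, φ x ∂(θ t).toMeasure) (𝓝[<] t) (𝓝 (g t)) :=
        ((hg.continuous.tendsto t).mono_left nhdsWithin_le_nhds).congr'
          (hIco.mono fun s hs => (hgθ hs).symm)
      simp only [hθ'T]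
      exact tendsto_nhds_unique h1 h2
    · simp only [hθ'lt htT]
      exact hgθ ⟨ht.1, htT⟩
  · filter_upwards [ae_all_iff.2 fun n => (hce n φ hφ hc).2, ae_ne T] with t ht htT htI
    exact ht _ ⟨htI.1, (hfind t (lt_of_le_of_ne htI.2 htT)).le⟩

/-! ### One attainability step and its cost. -/

lemma sigma_pos {d : ℕ} {p : ℝ} {Φ : Set (Rd d →ᵇ ℝ)} {μ : Pp d p}
    (h : μ ∉ genTargetP p Φ) : 0 < sigma Φ μ := by
  have h' : ¬∀ φ ∈ Φ, ∫ x, φ x ∂μ.toMeasure ≤ 0 := h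
  push Not at h'
  obtain ⟨φ, hφ, hpos⟩ := h'
  refine lt_of_lt_of_le (b := ((∫ x, φ x ∂μ.toMeasure : ℝ) : EReal)) (by exact_mod_cast hpos) ?_
  exact le_iSup₂ (f := fun φ (_ : φ ∈ Φ) => ((∫ x, φ x ∂μ.toMeasure : ℝ) : EReal)) φ hφ

/-- A measure outside the target is steered in time at most `r` to a measure at which `σ_Φ` has
decreased by at least `|Q|`. -/
lemma IsAttainable.exists_step {d : ℕ} {p L : ℝ} {F : Pp d p → Rd d → Set (Rd d)}
    {Φ : Set (Rd d →ᵇ ℝ)} (hσ : ∀ ν : Pp d p, 0 ≤ sigma Φ ν) {r : ℝ → ℝ} {Q : ℝ → ℝ → ℝ}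
    (h : IsAttainable F L Φ r Q) {μ : Pp d p} (hμ : μ ∉ genTargetP p Φ) :
    ∃ s : ℝ, 0 < s ∧ sigma Φ μ = (s : EReal) ∧ ∃ t, 0 < t ∧ t ≤ r s ∧
      ∃ θ ∈ admissibleTrajectories F 0 t μ, ∃ s' : ℝ, 0 ≤ s' ∧ sigma Φ (θ t) = (s' : EReal) ∧
        s' ≤ s - |Q (r s) s| := by
  obtain ⟨s, hs, θ, hθ, hinf⟩ := h.decrease μ hμ
  have hs0 : 0 < s := by have := sigma_pos hμ; rw [hs] at this; exact_mod_cast this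
  have hQ := h.Q_neg s hs0
  -- The factor `2` in the hypothesis gives slack: the infimum is strictly below `Q`, so an actual
  -- time achieves decrease `|Q|`.
  have hlt : (⨅ t ∈ Icc 0 (r s), (sigma Φ (θ t) - sigma Φ μ)) < ((Q (r s) s : ℝ) : EReal) :=
    hinf.trans_lt (by exact_mod_cast (by linarith : 2 * Q (r s) s < Q (r s) s))
  simp only [iInf_lt_iff] at hlt
  obtain ⟨t, ht, htlt⟩ := hlt
  have hne_top : sigma Φ (θ t) ≠ ⊤ := fun htop => by
    rw [htop, hs, EReal.top_sub_coe] at htlt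
    exact not_top_lt htlt
  have hne_bot : sigma Φ (θ t) ≠ ⊥ := fun hbot => by
    have := hσ (θ t)
    rw [hbot] at this
    exact absurd this (by simp)
  obtain ⟨s', hs'⟩ : ∃ s' : ℝ, sigma Φ (θ t) = (s' : EReal) :=
    ⟨_, (EReal.coe_toReal hne_top hne_bot).symm⟩
  have hs'0 : 0 ≤ s' := by have := hσ (θ t); rw [hs'] at this; exact_mod_cast this
  have hdec : s' - s < Q (r s) s := by rw [hs', hs] at htlt; exact_mod_cast htlt
  -- At time `0` there is no decrease. Positive durations later make the sequence of times strictly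
  -- increasing.
  have ht0 : t ≠ 0 := by
    rintro rfl
    rw [hθ.1, hs] at hs'
    have : s = s' := by exact_mod_cast hs'
    linarith
  refine ⟨s, hs0, hs, t, lt_of_le_of_ne ht.1 ht0.symm, ht.2, θ,
    admissibleTrajectories_mono hθ ht, s', hs'0, hs', ?_⟩
  rw [abs_of_neg hQ]; linarith

lemma IsAttainable.intervalIntegrable {d : ℕ} {p L : ℝ} {F : Pp d p → Rd d → Set (Rd d)}
    {Φ : Set (Rd d →ᵇ ℝ)} {r : ℝ → ℝ} {Q : ℝ → ℝ → ℝ} (h : IsAttainable F L Φ r Q) {a b : ℝ}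
    (ha : 0 ≤ a) (hb : 0 ≤ b) : IntervalIntegrable (fun q => r q / |Q (r q) q|) volume a b := by
  have hsub : uIcc a b ⊆ Ici 0 := fun t ht => (le_min ha hb).trans ht.1
  exact (h.integrable.integrableOn_compact_subset hsub isCompact_uIcc).intervalIntegrable

lemma IsAttainable.quotient_nonneg {d : ℕ} {p L : ℝ} {F : Pp d p → Rd d → Set (Rd d)}
    {Φ : Set (Rd d →ᵇ ℝ)} {r : ℝ → ℝ} {Q : ℝ → ℝ → ℝ} (h : IsAttainable F L Φ r Q) {q : ℝ}
    (hq : 0 ≤ q) : 0 ≤ r q / |Q (r q) q| :=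
  div_nonneg (h.r_mapsTo hq).1 (abs_nonneg _)

/-- By monotonicity the integrand on `(s', s)` is at least its value at `s`, and the interval has
length at least `|Q(r(s), s)|`. -/
lemma IsAttainable.r_le_integral {d : ℕ} {p L : ℝ} {F : Pp d p → Rd d → Set (Rd d)}
    {Φ : Set (Rd d →ᵇ ℝ)} {r : ℝ → ℝ} {Q : ℝ → ℝ → ℝ} (h : IsAttainable F L Φ r Q) {s s' : ℝ}
    (hs : 0 < s) (hs' : 0 ≤ s') (hle : s' ≤ s - |Q (r s) s|) :
    r s ≤ ∫ q in s'..s, r q / |Q (r q) q| := by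
  have hQ : 0 < |Q (r s) s| := abs_pos.2 (h.Q_neg s hs).ne
  have hss : s' ≤ s := by linarith
  have hconst : ∫ _ in s'..s, r s / |Q (r s) s| = (s - s') * (r s / |Q (r s) s|) := by
    rw [intervalIntegral.integral_const, smul_eq_mul]
  calc r s = |Q (r s) s| * (r s / |Q (r s) s|) := by field_simp
    _ ≤ (s - s') * (r s / |Q (r s) s|) :=
        mul_le_mul_of_nonneg_right (by linarith) (h.quotient_nonneg hs.le)
    _ = ∫ _ in s'..s, r s / |Q (r s) s| := hconst.symm
    _ ≤ _ := intervalIntegral.integral_mono_on_of_le_Ioo hss (by simp)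
        (h.intervalIntegrable hs' hs.le) fun q hq =>
          h.antitone (hs'.trans_lt hq.1) hs hq.2.le

/-- A positive sequence that decreases by at least `|Q|` at each step tends to zero. -/
lemma IsAttainable.tendsto_zero {d : ℕ} {p L : ℝ} {F : Pp d p → Rd d → Set (Rd d)}
    {Φ : Set (Rd d →ᵇ ℝ)} {r : ℝ → ℝ} {Q : ℝ → ℝ → ℝ} (h : IsAttainable F L Φ r Q) {s : ℕ → ℝ}
    (hs : ∀ n, 0 < s n) (hdec : ∀ n, s (n + 1) ≤ s n - |Q (r (s n)) (s n)|) :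
    Tendsto s atTop (𝓝 0) := by
  have hanti : Antitone s := antitone_nat_of_succ_le fun n => by
    linarith [hdec n, abs_nonneg (Q (r (s n)) (s n))]
  obtain ⟨l, hl⟩ : ∃ l, Tendsto s atTop (𝓝 l) :=
    ⟨_, tendsto_atTop_ciInf hanti ⟨0, by rintro _ ⟨n, rfl⟩; exact (hs n).le⟩⟩
  have hl0 : 0 ≤ l := ge_of_tendsto' hl fun n => (hs n).le
  rcases hl0.eq_or_lt with rfl | hlpos
  · exact hl
  exfalso
  have hsI : ∀ n, s n ∈ Ici (0 : ℝ) := fun n => (hs n).le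
  have hr : Tendsto (fun n => r (s n)) atTop (𝓝 (r l)) :=
    (h.r_continuous l hl0).tendsto.comp
      (tendsto_nhdsWithin_iff.2 ⟨hl, Eventually.of_forall hsI⟩)
  have hQ : Tendsto (fun n => Q (r (s n)) (s n)) atTop (𝓝 (Q (r l) l)) :=
    (h.Q_continuous (r l, l) ⟨h.r_mapsTo hl0, hl0⟩).tendsto.comp
      (tendsto_nhdsWithin_iff.2 ⟨hr.prodMk_nhds hl,
        Eventually.of_forall fun n => ⟨h.r_mapsTo (hsI n), hsI n⟩⟩)
  have hlim : Tendsto (fun n => s n - s (n + 1)) atTop (𝓝 (l - l)) :=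
    hl.sub (hl.comp (tendsto_add_atTop_nat 1))
  -- Successive differences dominate `|Q|` and vanish in the limit, so `Q` would vanish at a
  -- positive `l`.
  have := le_of_tendsto_of_tendsto' hQ.abs hlim fun n => by linarith [hdec n]
  rw [sub_self] at this
  exact (h.Q_neg l hlpos).ne (abs_eq_zero.1 (le_antisymm this (abs_nonneg _)))

lemma minTime_le {d : ℕ} {p T I : ℝ} {F : Pp d p → Rd d → Set (Rd d)} {Φ : Set (Rd d →ᵇ ℝ)}
    {μ : Pp d p} {θ : ℝ → Pp d p} (hT : 0 ≤ T) (hθ : θ ∈ admissibleTrajectories F 0 T μ)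
    (htarget : θ T ∈ genTargetP p Φ) (hI : T ≤ I) : minTime F Φ μ ≤ ENNReal.ofReal I := by
  lift T to ℝ≥0 using hT
  refine (iInf₂_le T ⟨θ, hθ, htarget⟩).trans ?_
  rw [← ENNReal.ofReal_coe_nnreal]
  exact ENNReal.ofReal_le_ofReal hI

/-! ### Infinite concatenation and the time estimate. -/

/-- The trajectory obtained by concatenating the trajectories `θ n` of durations `t n`. -/
def concatSeq {α : Type*} (x₀ : α) (τ : ℕ → ℝ) (θ : ℕ → ℝ → α) : ℕ → ℝ → α
  | 0 => fun _ => x₀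
  | n + 1 => concat (τ n) (concatSeq x₀ τ θ n) (θ n)

lemma concatSeq_eq {α : Type*} (x₀ : α) {τ : ℕ → ℝ} (hτ : Monotone τ) (θ : ℕ → ℝ → α) {n m : ℕ}
    (hnm : n ≤ m) {t : ℝ} (ht : t ≤ τ n) : concatSeq x₀ τ θ m t = concatSeq x₀ τ θ n t := by
  induction m, hnm using Nat.le_induction with
  | base => rfl
  | succ m hm ih => rw [← ih, concatSeq, concat, if_pos (ht.trans (hτ hm))]

lemma concatSeq_mem_admissibleTrajectories {d : ℕ} {p : ℝ} (hp : 1 ≤ p)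
    {F : Pp d p → Rd d → Set (Rd d)} {x : ℕ → Pp d p} {τ : ℕ → ℝ} {θ : ℕ → ℝ → Pp d p}
    (hτ0 : τ 0 = 0) (hτ : Monotone τ)
    (hθ : ∀ n, θ n ∈ admissibleTrajectories F 0 (τ (n + 1) - τ n) (x n))
    (hx : ∀ n, θ n (τ (n + 1) - τ n) = x (n + 1)) (n : ℕ) :
    concatSeq (x 0) τ θ n ∈ admissibleTrajectories F 0 (τ n) (x 0) ∧
      concatSeq (x 0) τ θ n (τ n) = x n := by
  induction n with
  | zero =>
    rw [hτ0]
    exact ⟨const_mem_admissibleTrajectories hp F 0 (x 0), rfl⟩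
  | succ n ih =>
    have hn : 0 ≤ τ n := hτ0 ▸ hτ n.zero_le
    have hstep : 0 ≤ τ (n + 1) - τ n := sub_nonneg.2 (hτ n.le_succ)
    have h := concat_mem_admissibleTrajectories hn hstep ih.1 (ih.2 ▸ hθ n)
    rw [add_sub_cancel] at h
    refine ⟨h, ?_⟩
    rw [concatSeq, concat]
    -- The first branch is a step of zero length, which occurs when the iteration is stationary.
    split_ifs with hle
    · have : τ (n + 1) = τ n := le_antisymm hle (hτ n.le_succ)
      rw [this, ih.2, ← hx n, this, sub_self]
      exact (hθ n).1.symm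
    · exact hx n

/-- Infinitely many trajectories of finite total duration can be concatenated. -/
lemma exists_trajectory_of_summable {d : ℕ} {p L : ℝ} (hp : 1 ≤ p)
    {F : Pp d p → Rd d → Set (Rd d)} (hF : IsLipschitzDynamics F L) {x : ℕ → Pp d p} {τ : ℕ → ℝ}
    {T : ℝ} {θ : ℕ → ℝ → Pp d p} (hτ0 : τ 0 = 0) (hτ : StrictMono τ)
    (hT : Tendsto τ atTop (𝓝 T))
    (hθ : ∀ n, θ n ∈ admissibleTrajectories F 0 (τ (n + 1) - τ n) (x n))
    (hx : ∀ n, θ n (τ (n + 1) - τ n) = x (n + 1)) :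
    ∃ Θ ∈ admissibleTrajectories F 0 T (x 0), Tendsto (fun n => (x n).1) atTop (𝓝 (Θ T).1) := by
  classical
  have hτn : ∀ n, 0 ≤ τ n := fun n => hτ0 ▸ hτ.monotone n.zero_le
  have hc := concatSeq_mem_admissibleTrajectories hp hτ0 hτ.monotone hθ hx
  -- Finite concatenations agree on overlaps, so any index reaching `t` may be used. The default `x
  -- 0` at `T` is overwritten by the extension.
  set Θ : ℝ → Pp d p := fun t =>
    if h : ∃ n, t ≤ τ n then concatSeq (x 0) τ θ (Nat.find h) t else x 0 with hΘ
  have hΘn : ∀ n t, t ≤ τ n → Θ t = concatSeq (x 0) τ θ n t := fun n t ht => by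
    have hex : ∃ n, t ≤ τ n := ⟨n, ht⟩
    simp only [hΘ, dif_pos hex]
    exact (concatSeq_eq (x 0) hτ.monotone θ (Nat.find_min' hex ht) (Nat.find_spec hex)).symm
  have hΘadm : ∀ n, Θ ∈ admissibleTrajectories F 0 (τ n) (x 0) := fun n =>
    admissibleTrajectories_congr (hτn n) (hc n).1 fun t ht => hΘn n t ht.2
  obtain ⟨μT, hμT, hlim⟩ := exists_update_mem_admissibleTrajectories hp hF hτ hτn hT hΘadm
  refine ⟨_, hμT, ?_⟩
  rw [Function.update_self]
  refine hlim.congr fun n => ?_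
  rw [hΘn n (τ n) le_rfl, (hc n).2]

theorem minTime_le_integral {d : ℕ} {p L : ℝ} (hp : 1 ≤ p) {F : Pp d p → Rd d → Set (Rd d)}
    (hF : IsLipschitzDynamics F L) {Φ : Set (Rd d →ᵇ ℝ)} (hσ : ∀ ν : Pp d p, 0 ≤ sigma Φ ν)
    {r : ℝ → ℝ} {Q : ℝ → ℝ → ℝ} (h : IsAttainable F L Φ r Q) (μ : Pp d p) :
    minTime F Φ μ ≤ ENNReal.ofReal (∫ q in (0 : ℝ)..(sigma Φ μ).toReal, r q / |Q (r q) q|) := by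
  set S : Pp d p → ℝ := fun ν => (sigma Φ ν).toReal with hS
  have hS0 : ∀ ν, 0 ≤ S ν := fun ν => EReal.toReal_nonneg (hσ ν)
  have hstep : ∀ ν : Pp d p, ∃ (t : ℝ) (θ : ℝ → Pp d p), 0 ≤ t ∧
      θ ∈ admissibleTrajectories F 0 t ν ∧
      t ≤ ∫ q in S (θ t)..S ν, r q / |Q (r q) q| ∧
      (ν ∉ genTargetP p Φ → 0 < t ∧ 0 < S ν ∧ sigma Φ ν = (S ν : EReal) ∧
        S (θ t) ≤ S ν - |Q (r (S ν)) (S ν)|) := by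
    intro ν
    by_cases hν : ν ∈ genTargetP p Φ
    -- Inside the target the step has duration `0`, which makes the iteration a total map.
    · exact ⟨0, fun _ => ν, le_rfl, const_mem_admissibleTrajectories hp F 0 ν, by simp,
        fun hn => absurd hν hn⟩
    · obtain ⟨s, hs, hsν, t, ht, htr, θ, hθ, s', hs', hsθ, hle⟩ := h.exists_step hσ hν
      have e : S ν = s := by simp [hS, hsν]
      have e' : S (θ t) = s' := by simp [hS, hsθ]
      refine ⟨t, θ, ht.le, hθ, ?_, fun _ => ⟨ht, ?_, ?_, ?_⟩⟩
      · rw [e, e']; exact htr.trans (h.r_le_integral hs hs' hle)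
      · rwa [e]
      · rw [e, hsν]
      · rwa [e, e']
  choose t θ ht hθ hint hout using hstep
  set x : ℕ → Pp d p := fun n => (fun ν => θ ν (t ν))^[n] μ with hx
  have hx0 : x 0 = μ := rfl
  have hxs : ∀ n, x (n + 1) = θ (x n) (t (x n)) := fun n => Function.iterate_succ_apply' _ n μ
  set τ : ℕ → ℝ := fun n => ∑ i ∈ Finset.range n, t (x i) with hτ
  have hτs : ∀ n, τ (n + 1) - τ n = t (x n) := fun n => by
    simp [hτ, Finset.sum_range_succ]
  have hτ0 : τ 0 = 0 := by simp [hτ]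
  have hτm : Monotone τ := monotone_nat_of_le_succ fun n => by linarith [hτs n, ht (x n)]
  have hθn : ∀ n, θ (x n) ∈ admissibleTrajectories F 0 (τ (n + 1) - τ n) (x n) := fun n => by
    rw [hτs]; exact hθ (x n)
  have hxn : ∀ n, θ (x n) (τ (n + 1) - τ n) = x (n + 1) := fun n => by rw [hτs, hxs]
  have hτint : ∀ n, τ n ≤ ∫ q in S (x n)..S μ, r q / |Q (r q) q| := by
    intro n
    induction n with
    | zero => simp [hτ0, hx0]
    | succ n ih =>
      have h1 := hint (x n)
      rw [← hxs] at h1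
      rw [← intervalIntegral.integral_add_adjacent_intervals
        (h.intervalIntegrable (hS0 (x (n + 1))) (hS0 (x n)))
        (h.intervalIntegrable (hS0 (x n)) (hS0 μ))]
      linarith [hτs n]
  have hτI : ∀ n, τ n ≤ ∫ q in (0 : ℝ)..S μ, r q / |Q (r q) q| := fun n => by
    refine (hτint n).trans ?_
    rw [← intervalIntegral.integral_add_adjacent_intervals (h.intervalIntegrable le_rfl (hS0 (x n)))
      (h.intervalIntegrable (hS0 (x n)) (hS0 μ))]
    have := intervalIntegral.integral_nonneg (μ := volume) (hS0 (x n))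
      fun q hq => h.quotient_nonneg hq.1
    linarith
  by_cases hhit : ∃ n, x n ∈ genTargetP p Φ
  · obtain ⟨n, hn⟩ := hhit
    have hc := concatSeq_mem_admissibleTrajectories (θ := fun n => θ (x n)) hp hτ0 hτm hθn hxn n
    exact minTime_le (hτ0 ▸ hτm n.zero_le) hc.1 (hc.2.symm ▸ hn) (hτI n)
  · push Not at hhit
    have hτsm : StrictMono τ := strictMono_nat_of_lt_succ fun n => by
      linarith [hτs n, (hout (x n) (hhit n)).1]
    have hT := tendsto_atTop_ciSup hτm ⟨_, by rintro _ ⟨n, rfl⟩; exact hτI n⟩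
    set T := ⨆ n, τ n
    have hTI : T ≤ ∫ q in (0 : ℝ)..S μ, r q / |Q (r q) q| := le_of_tendsto' hT hτI
    have hT0 : 0 ≤ T := ge_of_tendsto' hT fun n => hτ0 ▸ hτm n.zero_le
    obtain ⟨Θ, hΘ, hlim⟩ := exists_trajectory_of_summable (θ := fun n => θ (x n)) hp hF hτ0 hτsm hT
      hθn hxn
    refine minTime_le hT0 hΘ (fun φ hφ => ?_) hTI
    have hSlim : Tendsto (fun n => S (x n)) atTop (𝓝 0) :=
      h.tendsto_zero (fun n => (hout (x n) (hhit n)).2.1) fun n => by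
        rw [hxs]; exact (hout (x n) (hhit n)).2.2.2
    -- Lower semicontinuity of `σ_Φ` in action: each bounded continuous `φ` is tested along the
    -- narrowly convergent `x n`.
    refine le_of_tendsto_of_tendsto'
      (ProbabilityMeasure.tendsto_iff_forall_integral_tendsto.1 hlim φ) hSlim fun n => ?_
    have h1 : ((∫ y, φ y ∂(x n).toMeasure : ℝ) : EReal) ≤ sigma Φ (x n) :=
      le_iSup₂ (f := fun φ (_ : φ ∈ Φ) => ((∫ y, φ y ∂(x n).toMeasure : ℝ) : EReal)) φ hφ
    rw [(hout (x n) (hhit n)).2.2.1] at h1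
    exact_mod_cast h1

end

end WassersteinControl

theorem mainTheorem8 (d : ℕ) (p : ℝ) (hp : 1 ≤ p)
    (F : WassersteinControl.Pp d p →
      WassersteinControl.Rd d → Set (WassersteinControl.Rd d))
    (L : ℝ) (hF : WassersteinControl.IsLipschitzDynamics F L)
    (Φ : Set (WassersteinControl.Rd d →ᵇ ℝ))
    (hS : (WassersteinControl.genTarget Φ).Nonempty)
    (hσ : ∀ ν : WassersteinControl.Pp d p, 0 ≤ WassersteinControl.sigma Φ ν)
    (r : ℝ → ℝ) (Q : ℝ → ℝ → ℝ)
    (hrQ : WassersteinControl.IsAttainable F L Φ r Q)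
    (μ : WassersteinControl.Pp d p) :
    WassersteinControl.minTime F Φ μ ≤
      ENNReal.ofReal
        (∫ q in (0 : ℝ)..(WassersteinControl.sigma Φ μ).toReal, r q / |Q (r q) q|) := by
  exact WassersteinControl.minTime_le_integral hp hF hσ hrQ μ
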